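/- Let $K$ be a field. A *locality* of $K$ is an equivalence class of (Krull) valuations of $K$, an ordering of $K$, or an equivalence class of absolute values of $K$ (possibly complex), where rank-$1$ valuations and archimedean orderings are identified with the corresponding absolute values and the trivial absolute value with the trivial valuation. Let ${\rm S}(K)$ be the set of localities. For $v\in{\rm S}(K)$ let $\mathcal{O}_v$ be $\{x: v(x)\ge 0\}$, $\{x: -1\le_v x\le_v 1\}$ or $\{x: |x|_v\le 1\}$ respectively, and let $\mathfrak{m}_v$ be the set given by the corresponding strict inequalities; put $\mathcal{O}_v^\times=\mathcal{O}_v\setminus\mathfrak{m}_v$. If $\mathcal{O}_v\subseteq\mathcal{O}_w$, then $v$ is a *refinement* of $w$, and $w$ a *coarsening* of $v$; $v$ and $w$ are *incomparable* if neither refines the other. Let $v\vee w$ denote the finest common coarsening of $v$ and $w$. Call $v,w$ *strongly incomparable* if they are incomparable and induce distinct localities on the residue field of the valuation $v\vee w$. For $t\in K^\times$, call $v,w$ *$t$-independent* if $t\in\mathcal{O}_{v\vee w}^\times$ and, in case both are orderings, they are strongly incomparable. Two sets of localities are called incomparable (respectively $t$-independent) if every element of the first is incomparable to (respectively $t$-independent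 from) every element of the second. Consider two situations: in *Situation $\mathfrak{m}$* let $\mathfrak{B}_v=\mathfrak{m}_v$, in *Situation $\mathcal{O}$* let $\mathfrak{B}_v=\mathcal{O}_v$. In either situation endow ${\rm S}(K)$ with the topology with subbasis $\{v\in{\rm S}(K): x\in\mathfrak{B}_v\}$, $x\in K$. **Theorem.** Let $S_1,\dots,S_n\subseteq{\rm S}(K)$, $t\in K^\times$, $x_1,\dots,x_n\in K$ and $z_1,\dots,z_n\in K^\times$. * **(U)** Assume that there is a polynomial $f\in K[X]$ of degree $d\ge 2$ with leading coefficient $a_d$ such that for every $i$ and every $v\in S_i$: (i) $f(x)\in\mathcal{O}_v$ for all $x\in\mathcal{O}_v$; (ii) if $S_i$ is infinite, then $f(x)\notin t\mathfrak{m}_v$ for all $x\in\mathcal{O}_v$; (iii) $f(x)\in x^d(\mathcal{O}_v\setminus t\mathfrak{m}_v)\cap(a_dx^d+x^{d-1}\mathcal{O}_v)$ for all $x\in K\setminus\mathcal{O}_v$; (iv) $\mathcal{O}_v+\mathcal{O}_v\subseteq t^{-1}\mathcal{O}_v$. * **(T)** Assume that each $S_i$ is compact in the given topology. * **(I)** Assume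 that for all $i,j$ and any valuation $w$ on $K$ with a refinement in $S_i$ and a refinement in $S_j$ we have $w(x_i-x_j)\ge w(z_i)=w(z_j)$; assume further that the $S_i$ are pairwise $t$-independent, and in Situation $\mathfrak{m}$ furthermore pairwise incomparable. Then, in each of the two situations, there exists $x\in K$ with $$x-x_i\in z_i\mathfrak{B}_v\quad\text{for all } v\in S_i,\ i=1,\dots,n.$$ -/

import Mathlib

open scoped Pointwise

/-! ### Localities of a field

Equivalence classes of (Krull) valuations of `K` are Mathlib's `ValuationSubring K`.  A locality (a
valuation up to equivalence, an ordering, or an absolute value up to equivalence) is represented by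
its closed unit ball, which determines it; rank one valuations and archimedean orderings are thereby
identified with the absolute values they induce. -/

section Localities

variable {K : Type*} [Field K]

/-- `B = {x | 0 ≤ v x}` (additively written) for a valuation `v` of `K`. -/
def IsValuationBall (B : Set K) : Prop :=
  ∃ A : ValuationSubring K, B = {x | x ∈ A}

/-- `B = {x | -1 ≤ x ≤ 1}` for a field ordering of `K`. -/
def IsOrderingBall (B : Set K) : Prop :=
  ∃ (_ : LinearOrder K) (_ : IsStrictOrderedRing K), B = {x | -1 ≤ x ∧ x ≤ 1}

/-- `B = {x | |x| ≤ 1}` for an absolute value of `K` (possibly archimedean, real or complex). -/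
def IsAbsoluteValueBall (B : Set K) : Prop :=
  ∃ a : AbsoluteValue K ℝ, B = {x | a x ≤ 1}

variable (K) in
/-- The set `S(K)` of localities of `K`; `ball` is the set `𝒪_v`. -/
@[ext]
structure Locality where
  ball : Set K
  isLocality : IsValuationBall ball ∨ IsOrderingBall ball ∨ IsAbsoluteValueBall ball

namespace Locality

/-- The locality given by a valuation. -/
def ofValuation (A : ValuationSubring K) : Locality K where
  ball := {x | x ∈ A}
  isLocality := Or.inl ⟨A, rfl⟩

/-- `v` is an ordering (an archimedean ordering being the same locality as its absolute value). -/
def IsOrdering (v : Locality K) : Prop := IsOrderingBall v.ball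

/-- `𝒪_v^× = 𝒪_v ∩ 𝒪_v⁻¹`. -/
def units (v : Locality K) : Set K := {x | x ∈ v.ball ∧ x ≠ 0 ∧ x⁻¹ ∈ v.ball}

/-- `𝔪_v = 𝒪_v \ 𝒪_v^×`, the open unit ball of `v`. -/
def openBall (v : Locality K) : Set K := v.ball \ v.units

/-- `𝔪_v = {x | v x > 0}` (additively written) for valuations. -/
theorem openBall_of_valuation (v : Locality K) (A : ValuationSubring K)
    (h : v.ball = {x | x ∈ A}) : v.openBall = {x | A.valuation x < 1} := by
  ext x
  by_cases hx : x = 0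
  · subst hx; simp [openBall, units, h, A.zero_mem]
  · simp only [openBall, units, h, Set.mem_sdiff, Set.mem_ofPred_eq, ← A.valuation_le_one_iff,
      map_inv₀, not_and, not_le]
    have h0 : 0 < A.valuation x := zero_lt_iff.mpr ((map_ne_zero _).mpr hx)
    rw [one_lt_inv₀ h0]
    exact ⟨fun H => H.2 H.1 hx, fun H => ⟨H.le, fun _ _ => H⟩⟩

/-- `𝔪_v = {x | -1 < x < 1}` for orderings. -/
theorem openBall_of_ordering (v : Locality K) [LinearOrder K] [IsStrictOrderedRing K]
    (h : v.ball = {x | -1 ≤ x ∧ x ≤ 1}) : v.openBall = {x | -1 < x ∧ x < 1} := by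
  ext x
  by_cases hx : x = 0
  · subst hx; simp [openBall, units, h]
  · simp only [openBall, units, h, Set.mem_sdiff, Set.mem_ofPred_eq, ← abs_le, ← abs_lt,
      abs_inv, not_and, not_le]
    rw [one_lt_inv₀ (abs_pos.mpr hx)]
    exact ⟨fun H => H.2 H.1 hx, fun H => ⟨H.le, fun _ _ => H⟩⟩

/-- `𝔪_v = {x | |x| < 1}` for absolute values. -/
theorem openBall_of_absoluteValue (v : Locality K) (a : AbsoluteValue K ℝ)
    (h : v.ball = {x | a x ≤ 1}) : v.openBall = {x | a x < 1} := by
  ext x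
  by_cases hx : x = 0
  · subst hx; simp [openBall, units, h]
  · simp only [openBall, units, h, Set.mem_sdiff, Set.mem_ofPred_eq, map_inv₀, not_and, not_le]
    rw [one_lt_inv₀ (a.pos hx)]
    exact ⟨fun H => H.2 H.1 hx, fun H => ⟨H.le, fun _ _ => H⟩⟩

/-- `v ≤ w` means that `v` is a refinement of `w`, i.e. `w` is a coarsening of `v`.
Consequently the finest common coarsening of `v` and `w` is their least upper bound. -/
instance : PartialOrder (Locality K) :=
  PartialOrder.lift Locality.ball fun _ _ h => Locality.ext h

/-- The valuation `A` has a refinement in `S`. -/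
def HasRefinementIn (A : ValuationSubring K) (S : Set (Locality K)) : Prop :=
  ∃ v ∈ S, v ≤ ofValuation A

/-- Neither locality is a refinement of the other. -/
def Incomparable (v w : Locality K) : Prop := ¬ v ≤ w ∧ ¬ w ≤ v

/-- For a valuation `A` coarsening `v`: the closed unit ball of the locality induced by `v` on the
residue field of `A`, which is the image of `𝒪_v` under the residue map. -/
def residueBall (v : Locality K) (A : ValuationSubring K) : Set (IsLocalRing.ResidueField A) :=
  IsLocalRing.residue A '' {a : A | (a : K) ∈ v.ball}

/-- `v` and `w` are incomparable and induce distinct localities on the residue field of their finest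
common coarsening (which is a valuation as `v` and `w` are incomparable). -/
def StronglyIncomparable (v w : Locality K) : Prop :=
  Incomparable v w ∧ ∃ A : ValuationSubring K, IsLUB {v, w} (ofValuation A) ∧
    residueBall v A ≠ residueBall w A

/-- `t` is a unit of the finest common coarsening of `v` and `w`, and `v` and `w` are strongly
incomparable if both are orderings. -/
def TIndependent (t : K) (v w : Locality K) : Prop :=
  (∃ u : Locality K, IsLUB {v, w} u ∧ t ∈ u.units) ∧
    (v.IsOrdering → w.IsOrdering → StronglyIncomparable v w)

end Locality

/-! ### The two situations -/

/-- Situation `𝔪` and Situation `𝒪`. -/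
inductive Situation
  | m
  | O

/-- `𝔅_v`: the open ball `𝔪_v` in Situation `𝔪`, the closed ball `𝒪_v` in Situation `𝒪`. -/
def Situation.ball : Situation → Locality K → Set K
  | .m, v => v.openBall
  | .O, v => v.ball

/-- The topology on `S(K)` with subbasis `{v | x ∈ 𝔅_v}`, `x ∈ K`: the Zariski topology in
Situation `𝒪`, its Hochster dual in Situation `𝔪`. -/
abbrev Situation.topology (s : Situation) : TopologicalSpace (Locality K) :=
  TopologicalSpace.generateFrom (Set.range fun x : K => {v : Locality K | x ∈ s.ball v})

/-! ### The conditions of the uniformity assumption -/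

/-- `f` maps `𝒪_v` into itself. -/
def CondIntegral (f : Polynomial K) (v : Locality K) : Prop :=
  ∀ x ∈ v.ball, f.eval x ∈ v.ball

/-- `f` has no approximate zero in `𝒪_v`. -/
def CondNoApproxZero (f : Polynomial K) (t : K) (v : Locality K) : Prop :=
  ∀ x ∈ v.ball, f.eval x ∉ t • v.openBall

/-- For `x ∉ 𝒪_v`: `f x ∈ x^d (𝒪_v \ t 𝔪_v) ∩ (a_d x^d + x^(d-1) 𝒪_v)`, where `d` is the degree and
`a_d` the leading coefficient of `f`. -/
def CondLeadingTerm (f : Polynomial K) (t : K) (v : Locality K) : Prop :=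
  ∀ x ∉ v.ball,
    f.eval x ∈ (x ^ f.natDegree • (v.ball \ t • v.openBall)) ∩
      ({f.leadingCoeff * x ^ f.natDegree} + x ^ (f.natDegree - 1) • v.ball)

/-- `𝒪_v + 𝒪_v ⊆ t⁻¹ 𝒪_v`. -/
def CondPlus (t : K) (v : Locality K) : Prop :=
  v.ball + v.ball ⊆ t⁻¹ • v.ball

/-- The uniformity assumption with exceptional localities: a single polynomial of degree at least
two satisfies all conditions on every `S i`, except that the absence of approximate zeros is
imposed only on the infinite ones among the `S i`. -/
def ExceptionalAssumption {n : ℕ} (S : Fin n → Set (Locality K)) (t : K) : Prop :=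
  ∃ f : Polynomial K, 2 ≤ f.natDegree ∧
    (∀ i, ∀ v ∈ S i, CondIntegral f v ∧ CondLeadingTerm f t v ∧ CondPlus t v) ∧
    (∀ i, (S i).Infinite → ∀ v ∈ S i, CondNoApproxZero f t v)

end Localities

-- Every locality v has a multiplicative size function |·|_v with values in an ordered group with
-- zero, and (iv) says that |t|_v |x + y|_v ≤ max(|x|_v, |y|_v). So valuations, orderings and
-- absolute values can be treated alike, as ultrametric up to a factor t.
--
-- Let p and q solve the problem on two disjoint parts I and J of the family, and let e be close to
-- 1 on I and close to 0 on J. Then q + (p - q)e solves it on the union (`Approximable.union`),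
-- provided p, q and e were taken with some powers of t in reserve. Such an e comes from an element
-- y that is small on I and big on J. If F is the homogenization of f, take e = a_d / F(1, y), or e
-- = 1/(1 + y) when both parts are finite (`exists_partition_of_separating`).
--
-- For two single localities, y comes from `exists_lt_and_lt_of_incomparable`. If separation fails,
-- some multiplicatively closed set contains both unit balls. If it is closed under addition, it is
-- a valuation ring, and v and w turn out comparable. If not, v and w are orderings inducing the
-- same locality on the residue field of v ∨ w. The compatibility condition on the x_i and z_i makes
-- the required precision at least 1 on all common coarsenings, which is what separation needs.
--
-- To pass to sets of localities (`exists_separating`), elements are combined by F(p, q), which has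
-- the size of max(|p|, |q|)^d up to t when f has no approximate zeros; compactness reduces this to
-- finitely many combinations. On finite sets f may have approximate zeros, and p² + q^k with a
-- suitable k replaces F(p, q). This needs strict inequalities, so in Situation 𝒪 the finite sets
-- are first thinned out (`exists_reduced_family`) and then treated as in Situation 𝔪.

universe u

/-- Lifting puts the value groups of absolute values into the universe of `K`, where those of
valuations and orderings already live. -/
noncomputable instance : LinearOrderedCommGroupWithZero (ULift.{u} NNReal) where
  __ := (inferInstance : CommGroupWithZero (ULift.{u} NNReal))
  __ := (inferInstance : LinearOrder (ULift.{u} NNReal))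
  bot := ⟨0⟩
  bot_le x := show (0 : NNReal) ≤ x.down from zero_le
  isBot_zero x := show (0 : NNReal) ≤ x.down from zero_le
  mul_lt_mul_of_pos_left _ ha _ _ h := mul_lt_mul_of_pos_left (α := NNReal) h ha

/-! ### Size functions of localities -/

namespace Locality

variable {K : Type u} [Field K]

theorem exists_size (v : Locality K) :
    ∃ (Γ : Type u) (_ : LinearOrderedCommGroupWithZero Γ) (φ : K →*₀ Γ),
      ∀ x, x ∈ v.ball ↔ φ x ≤ 1 := by
  rcases v.isLocality with ⟨A, hA⟩ | ⟨_, _, h⟩ | ⟨a, ha⟩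
  · refine ⟨A.ValueGroup, inferInstance, A.valuation.toMonoidWithZeroHom, fun x => ?_⟩
    rw [hA]
    exact (A.valuation_le_one_iff x).symm
  · refine ⟨{x : K // 0 ≤ x}, inferInstance,
      { toFun x := ⟨|x|, abs_nonneg x⟩
        map_zero' := Subtype.ext abs_zero
        map_one' := Subtype.ext abs_one
        map_mul' x y := Subtype.ext (abs_mul x y) }, fun x => ?_⟩
    rw [h]
    exact abs_le.symm
  · refine ⟨ULift NNReal, inferInstance,
      { toFun x := ⟨⟨a x, a.nonneg x⟩⟩
        map_zero' := ULift.ext _ _ (NNReal.eq (map_zero a))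
        map_one' := ULift.ext _ _ (NNReal.eq (map_one a))
        map_mul' x y := ULift.ext _ _ (NNReal.eq (map_mul a x y)) }, fun x => ?_⟩
    rw [ha]
    exact Iff.rfl

/-- The group of sizes of elements of `K` with respect to a locality. -/
def SizeGroup (v : Locality K) : Type u := v.exists_size.choose

noncomputable instance (v : Locality K) : LinearOrderedCommGroupWithZero v.SizeGroup :=
  v.exists_size.choose_spec.choose

/-- The multiplicative size function with closed unit ball `v.ball`. -/
noncomputable def size (v : Locality K) : K →*₀ v.SizeGroup :=
  v.exists_size.choose_spec.choose_spec.choose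

theorem mem_ball {v : Locality K} {x : K} : x ∈ v.ball ↔ v.size x ≤ 1 :=
  v.exists_size.choose_spec.choose_spec.choose_spec x

theorem mem_units {v : Locality K} {x : K} : x ∈ v.units ↔ v.size x = 1 := by
  simp only [units, Set.mem_ofPred_eq, mem_ball, map_inv₀]
  constructor
  · rintro ⟨h, h0, h'⟩
    have : 0 < v.size x := zero_lt_iff.mpr ((map_ne_zero _).mpr h0)
    exact le_antisymm h ((inv_le_one₀ this).mp h')
  · intro h
    refine ⟨h.le, ?_, by simp [h]⟩
    rintro rfl
    simp at h

theorem mem_openBall {v : Locality K} {x : K} : x ∈ v.openBall ↔ v.size x < 1 := by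
  simp only [openBall, Set.mem_sdiff, mem_units, mem_ball, lt_iff_le_and_ne, ne_eq]

theorem size_pos {v : Locality K} {x : K} (hx : x ≠ 0) : 0 < v.size x :=
  zero_lt_iff.mpr ((map_ne_zero _).mpr hx)

theorem mem_smul_ball {v : Locality K} {a x : K} (ha : a ≠ 0) :
    x ∈ a • v.ball ↔ v.size x ≤ v.size a := by
  rw [Set.mem_smul_set_iff_inv_smul_mem₀ ha, smul_eq_mul, mem_ball, map_mul, map_inv₀,
    inv_mul_le_one₀ (size_pos ha)]

theorem mem_smul_openBall {v : Locality K} {a x : K} (ha : a ≠ 0) :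
    x ∈ a • v.openBall ↔ v.size x < v.size a := by
  rw [Set.mem_smul_set_iff_inv_smul_mem₀ ha, smul_eq_mul, mem_openBall, map_mul, map_inv₀,
    inv_mul_lt_one₀ (size_pos ha)]

theorem size_neg_one (v : Locality K) : v.size (-1) = 1 := by
  have h : v.size (-1) ^ 2 = 1 := by rw [← map_pow]; simp
  exact (pow_eq_one_iff_of_nonneg zero_le two_ne_zero).mp h

theorem size_neg (v : Locality K) (x : K) : v.size (-x) = v.size x := by
  rw [← neg_one_mul, map_mul, size_neg_one, one_mul]

theorem size_sub_comm (v : Locality K) (x y : K) : v.size (x - y) = v.size (y - x) := by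
  rw [← size_neg, neg_sub]

theorem le_iff {v w : Locality K} : v ≤ w ↔ ∀ x, v.size x ≤ 1 → w.size x ≤ 1 :=
  ⟨fun h _ hx => mem_ball.mp (h (mem_ball.mpr hx)),
    fun h x hx => mem_ball.mpr (h x (mem_ball.mp hx))⟩

theorem size_le_size_of_le {v w : Locality K} (h : v ≤ w) {x y : K} (hxy : v.size x ≤ v.size y) :
    w.size x ≤ w.size y := by
  by_cases hy : y = 0
  · subst hy
    rw [map_zero, le_zero_iff, map_eq_zero] at hxy
    simp [hxy]
  · have := le_iff.mp h (x / y) (by rw [map_div₀]; exact div_le_one_of_le₀ hxy zero_le)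
    rwa [map_div₀, div_le_one₀ (size_pos hy)] at this

theorem size_lt_size_of_le {v w : Locality K} (h : v ≤ w) {x y : K} (hxy : w.size x < w.size y) :
    v.size x < v.size y :=
  lt_of_not_ge fun h' => hxy.not_ge (size_le_size_of_le h h')

theorem size_ofValuation_le {A : ValuationSubring K} {x y : K} :
    (ofValuation A).size x ≤ (ofValuation A).size y ↔ A.valuation x ≤ A.valuation y := by
  by_cases hy : y = 0
  · simp [hy]
  · rw [← mem_smul_ball hy, Set.mem_smul_set_iff_inv_smul_mem₀ hy, smul_eq_mul]
    change y⁻¹ * x ∈ A ↔ _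
    rw [← A.valuation_le_one_iff, map_mul, map_inv₀, inv_mul_le_one₀]
    exact zero_lt_iff.mpr ((map_ne_zero _).mpr hy)

/-- Dividing by the larger summand reduces this to a sum of two elements of the unit ball. -/
theorem size_add_of_condPlus {v : Locality K} {t : K} (ht : t ≠ 0) (h : CondPlus t v) (x y : K) :
    v.size t * v.size (x + y) ≤ max (v.size x) (v.size y) := by
  wlog hxy : v.size y ≤ v.size x generalizing x y
  · rw [add_comm, max_comm]
    exact this y x (le_of_not_ge hxy)
  rw [max_eq_left hxy]
  by_cases hx : x = 0
  · subst hx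
    rw [map_zero, le_zero_iff, map_eq_zero] at hxy
    simp [hxy]
  have h1 : 1 + y / x ∈ t⁻¹ • v.ball := h <| Set.add_mem_add (by simp [mem_ball]) <| by
    rw [mem_ball, map_div₀]; exact div_le_one_of_le₀ hxy zero_le
  rw [mem_smul_ball (inv_ne_zero ht), map_inv₀] at h1
  have h2 : x + y = x * (1 + y / x) := by field_simp
  rw [h2, map_mul, mul_left_comm]
  refine mul_le_of_le_one_right zero_le ?_
  exact (le_inv_mul_iff₀ (size_pos ht)).mp (by rwa [mul_one])

theorem size_le_one_of_condPlus {v : Locality K} {t : K} (ht : t ≠ 0) (h : CondPlus t v) :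
    v.size t ≤ 1 := by
  simpa using size_add_of_condPlus ht h 1 0

/-- A sum is not much smaller than its dominating summand. -/
theorem size_mul_le_size_add {v : Locality K} {t : K} (ht : t ≠ 0) (h : CondPlus t v) {x y : K}
    (hxy : v.size x < v.size t * v.size y) : v.size t * v.size y ≤ v.size (x + y) := by
  by_contra! hlt
  have := size_add_of_condPlus ht h (x + y) (-x)
  rw [add_neg_cancel_comm, size_neg] at this
  exact this.not_gt (max_lt hlt hxy)

end Locality

/-! ### Polynomial substitutes for the maximum of two sizes -/

namespace Locality
variable {K : Type u} [Field K]

theorem condIntegral_size {f : Polynomial K} {v : Locality K} (h : CondIntegral f v) {x : K}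
    (hx : v.size x ≤ 1) : v.size (f.eval x) ≤ 1 :=
  mem_ball.mp (h x (mem_ball.mpr hx))

theorem condNoApproxZero_size {f : Polynomial K} {t : K} (ht : t ≠ 0) {v : Locality K}
    (h : CondNoApproxZero f t v) {x : K} (hx : v.size x ≤ 1) : v.size t ≤ v.size (f.eval x) :=
  le_of_not_gt fun h' => h x (mem_ball.mpr hx) ((mem_smul_openBall ht).mpr h')

theorem condLeadingTerm_size {f : Polynomial K} {t : K} (ht : t ≠ 0) {v : Locality K}
    (h : CondLeadingTerm f t v) {x : K} (hx : 1 < v.size x) :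
    v.size (f.eval x) ≤ v.size x ^ f.natDegree ∧
    v.size t * v.size x ^ f.natDegree ≤ v.size (f.eval x) ∧
    v.size (f.eval x - f.leadingCoeff * x ^ f.natDegree) ≤ v.size x ^ (f.natDegree - 1) := by
  have hx0 : x ≠ 0 := by rintro rfl; simp at hx
  obtain ⟨⟨y, ⟨hy1, hy2⟩, hy⟩, ⟨_, rfl, z, hz, hyz⟩⟩ := h x (by rwa [mem_ball, not_le])
  rw [mem_smul_openBall ht, not_lt] at hy2
  rw [mem_ball] at hy1
  rw [mem_smul_ball (pow_ne_zero _ hx0)] at hz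
  simp only [smul_eq_mul] at hy
  simp only [] at hyz
  refine ⟨?_, ?_, ?_⟩
  · rw [← hy, map_mul, map_pow]
    exact mul_le_of_le_one_right zero_le hy1
  · rw [← hy, map_mul, map_pow, mul_comm]
    gcongr
  · rw [← hyz, add_sub_cancel_left, ← map_pow]
    exact hz

/-- At any x outside the unit ball, both f(x) and its difference from the leading term have size at
most |x|^d. If there is no such x, everything has size at most 1. -/
theorem size_leadingCoeff_le {f : Polynomial K} {t : K} (ht : t ≠ 0) {v : Locality K}
    (hplus : CondPlus t v) (h : CondLeadingTerm f t v) :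
    v.size t * v.size f.leadingCoeff ≤ 1 := by
  by_cases hx : ∃ x, 1 < v.size x
  · obtain ⟨x, hx⟩ := hx
    have hx0 : x ≠ 0 := by rintro rfl; simp at hx
    obtain ⟨h1, -, h3⟩ := condLeadingTerm_size ht h hx
    rw [← size_neg, neg_sub] at h3
    have h4 := size_add_of_condPlus ht hplus (f.leadingCoeff * x ^ f.natDegree - f.eval x)
      (f.eval x)
    rw [sub_add_cancel, map_mul, ← mul_assoc, map_pow] at h4
    have h5 := h4.trans (max_le (h3.trans (pow_le_pow_right₀ hx.le (Nat.sub_le _ _))) h1)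
    exact (mul_le_iff_le_one_left (pow_pos (size_pos hx0) _)).mp h5
  · push Not at hx
    rw [← map_mul]
    exact hx _

/-- A modified homogenization of `f`, used for combining elements. -/
noncomputable def form (f : Polynomial K) (p q : K) : K := by
  classical exact if q = 0 then p ^ f.natDegree else q ^ f.natDegree * f.eval (p / q)

theorem size_form_le {f : Polynomial K} {t : K} (ht : t ≠ 0) {v : Locality K}
    (hint : CondIntegral f v) (hlead : CondLeadingTerm f t v) (p q : K) :
    v.size (form f p q) ≤ max (v.size p) (v.size q) ^ f.natDegree := by
  unfold form
  split_ifs with hq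
  · rw [map_pow]
    gcongr
    exact le_max_left _ _
  · rw [map_mul, map_pow]
    rcases le_or_gt (v.size (p / q)) 1 with h | h
    · refine (mul_le_of_le_one_right zero_le (condIntegral_size hint h)).trans ?_
      gcongr
      exact le_max_right _ _
    · calc _ ≤ v.size q ^ f.natDegree * v.size (p / q) ^ f.natDegree := by
            gcongr
            exact (condLeadingTerm_size ht hlead h).1
        _ = v.size p ^ f.natDegree := by
            rw [← mul_pow, ← map_mul, mul_div_cancel₀ _ hq]
        _ ≤ _ := by gcongr; exact le_max_left _ _

/-- Together with `size_form_le` this makes `form` a d-th power of the maximum up to the factor t.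
Only the lower bound needs the absence of approximate zeros. -/
theorem le_size_form {f : Polynomial K} {t : K} (ht : t ≠ 0) {v : Locality K}
    (hplus : CondPlus t v)
    (hzero : CondNoApproxZero f t v) (hlead : CondLeadingTerm f t v) (p q : K) :
    v.size t * max (v.size p) (v.size q) ^ f.natDegree ≤ v.size (form f p q) := by
  unfold form
  split_ifs with hq
  · subst hq
    rw [map_pow, map_zero, max_eq_left zero_le]
    exact mul_le_of_le_one_left zero_le (size_le_one_of_condPlus ht hplus)
  · rw [map_mul, map_pow]
    rcases le_or_gt (v.size (p / q)) 1 with h | h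
    · have h' : v.size p ≤ v.size q := by rwa [map_div₀, div_le_one₀ (size_pos hq)] at h
      rw [max_eq_right h', mul_comm]
      gcongr
      exact condNoApproxZero_size ht hzero h
    · have h' : v.size q ≤ v.size p := by rw [map_div₀, one_lt_div₀ (size_pos hq)] at h; exact h.le
      rw [max_eq_left h']
      calc _ = v.size q ^ f.natDegree * (v.size t * v.size (p / q) ^ f.natDegree) := by
            rw [mul_left_comm, ← mul_pow, ← map_mul, mul_div_cancel₀ _ hq]
        _ ≤ _ := by
            gcongr
            exact (condLeadingTerm_size ht hlead h).2.1

/-- Sums with a sufficiently large power behave like maxima at a given locality. -/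
theorem finite_bad_exponents {t : K} (ht : t ≠ 0) {v : Locality K} (hplus : CondPlus t v)
    {p q : K} (h : 1 < v.size t ^ 2 * v.size p ∨ 1 < v.size t ^ 2 * v.size q) :
    {k : ℕ | v.size t * v.size p ^ 2 ≤ v.size q ^ k ∧
      v.size t * v.size q ^ k ≤ v.size p ^ 2}.Finite := by
  set T := v.size t with hT
  set P := v.size p
  set Q := v.size q
  have hT0 : 0 < T := size_pos ht
  have hT1 : T ≤ 1 := size_le_one_of_condPlus ht hplus
  by_contra hinf
  have hinf : {k : ℕ | T * P ^ 2 ≤ Q ^ k ∧ T * Q ^ k ≤ P ^ 2}.Infinite := hinf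
  obtain ⟨m, hm1, hm2⟩ := hinf.nonempty
  have hP : v.size t ^ 2 * v.size p > 1 → 1 < T ^ 3 * P ^ 2 := fun h => by
    calc 1 < (T ^ 2 * P) ^ 2 := one_lt_pow₀ h two_ne_zero
      _ = T ^ 4 * P ^ 2 := by rw [mul_pow, ← pow_mul]
      _ ≤ T ^ 3 * P ^ 2 := by
        gcongr ?_ * _
        exact pow_le_pow_of_le_one zero_le hT1 (by norm_num)
  rcases le_or_gt Q 1 with hQ | hQ
  · rcases h with h | h
    · refine (hP h).not_ge (le_trans ?_ (hm1.trans (pow_le_one₀ zero_le hQ)))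
      gcongr
      exact pow_le_of_le_one zero_le hT1 (by norm_num)
    · exact h.not_ge (mul_le_one' (pow_le_one₀ zero_le hT1) hQ)
  -- For bad exponents m < n both Q^m and Q^n lie within a factor T of P², so T² Q^(n-m) ≤ 1. As n
  -- is unbounded, every power of Q is bounded by T⁻².
  have key : ∀ k, T ^ 2 * Q ^ k ≤ 1 := by
    intro k
    obtain ⟨n, ⟨-, hn2⟩, hn⟩ := hinf.exists_gt (m + k)
    have hle : (T ^ 2 * Q ^ k) * Q ^ m ≤ 1 * Q ^ m := by
      calc (T ^ 2 * Q ^ k) * Q ^ m = T * (T * Q ^ (m + k)) := by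
            rw [pow_add, pow_two, mul_comm (Q ^ m)]
            simp only [mul_assoc]
        _ ≤ T * (T * Q ^ n) := by gcongr; exact hQ.le
        _ ≤ T * P ^ 2 := by gcongr
        _ ≤ 1 * Q ^ m := by rwa [one_mul]
    exact le_of_mul_le_mul_right hle (pow_pos (zero_lt_one.trans hQ) _)
  rcases h with h | h
  · refine (hP h).not_ge ?_
    calc T ^ 3 * P ^ 2 = T ^ 2 * (T * P ^ 2) := by rw [← mul_assoc, ← pow_succ]
      _ ≤ T ^ 2 * Q ^ m := by gcongr
      _ ≤ 1 := key m
  · exact h.not_ge (by simpa using key 1)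

end Locality

/-! ### Strict and non-strict comparison, according to the situation -/

/-- The comparison of sizes that describes membership in `a • s.ball v`. -/
def Situation.Rel {Γ : Type*} [LinearOrder Γ] : Situation → Γ → Γ → Prop
  | .m, x, y => x < y
  | .O, x, y => x ≤ y

namespace Situation
variable {Γ : Type*} [LinearOrder Γ] {s : Situation} {x y z : Γ}

theorem Rel.le (h : s.Rel x y) : x ≤ y := by
  cases s
  exacts [le_of_lt h, h]

theorem rel_of_lt (h : x < y) : s.Rel x y := by
  cases s
  exacts [h, h.le]

theorem Rel.trans_le (h : s.Rel x y) (h' : y ≤ z) : s.Rel x z := by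
  cases s
  exacts [lt_of_lt_of_le h h', le_trans h h']

theorem Rel.le_trans (h : s.Rel y z) (h' : x ≤ y) : s.Rel x z := by
  cases s
  exacts [lt_of_le_of_lt h' h, _root_.le_trans h' h]

theorem Rel.max (h : s.Rel x z) (h' : s.Rel y z) : s.Rel (max x y) z := by
  rcases max_choice x y with e | e <;> rw [e] <;> assumption

theorem Rel.mul_left {Γ : Type*} [LinearOrderedCommGroupWithZero Γ] {x y c : Γ} (hc : 0 < c)
    (h : s.Rel x y) : s.Rel (c * x) (c * y) := by
  cases s
  exacts [mul_lt_mul_of_pos_left h hc, mul_le_mul_right h c]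

theorem Rel.of_mul_left {Γ : Type*} [LinearOrderedCommGroupWithZero Γ] {x y c : Γ} (hc : 0 < c)
    (h : s.Rel (c * x) (c * y)) : s.Rel x y := by
  simpa [inv_mul_cancel_left₀ hc.ne'] using h.mul_left (inv_pos.mpr hc)

theorem mem_smul_ball {K : Type*} [Field K] (s : Situation) {v : Locality K} {a x : K}
    (ha : a ≠ 0) : x ∈ a • s.ball v ↔ s.Rel (v.size x) (v.size a) := by
  cases s
  exacts [Locality.mem_smul_openBall ha, Locality.mem_smul_ball ha]

theorem isOpen_setOf_rel {K : Type*} [Field K] (s : Situation) {a : K} (ha : a ≠ 0) (x : K) :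
    @IsOpen _ s.topology {v : Locality K | s.Rel (v.size x) (v.size a)} := by
  refine TopologicalSpace.isOpen_generateFrom_of_mem ⟨a⁻¹ * x, ?_⟩
  ext v
  rw [Set.mem_ofPred_eq, Set.mem_ofPred_eq, ← mem_smul_ball s ha,
    Set.mem_smul_set_iff_inv_smul_mem₀ ha, smul_eq_mul]

end Situation

/-! ### Small and big elements -/

namespace Locality
variable {K : Type u} [Field K] {s : Situation} {a t p q : K} {v : Locality K}

/-- `y ∈ a • 𝔅_v ∩ t ^ 2 • 𝔅_v`. -/
def Small (s : Situation) (a t : K) (v : Locality K) (y : K) : Prop :=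
  s.Rel (v.size y) (v.size a) ∧ s.Rel (v.size y) (v.size t ^ 2)

/-- The inverse of `y` is small. -/
def Big (s : Situation) (a t : K) (v : Locality K) (y : K) : Prop :=
  y ≠ 0 ∧ Small s a t v y⁻¹

theorem Small.mono (h : Small s a t v p) (hq : v.size q ≤ v.size p) : Small s a t v q :=
  ⟨h.1.le_trans hq, h.2.le_trans hq⟩

theorem Big.mono (h : Big s a t v p) (hq : v.size p ≤ v.size q) : Big s a t v q := by
  have hq0 : q ≠ 0 := by
    rintro rfl
    rw [map_zero, le_zero_iff, map_eq_zero] at hq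
    exact h.1 hq
  refine ⟨hq0, h.2.mono ?_⟩
  rw [map_inv₀, map_inv₀]
  exact inv_anti₀ (size_pos h.1) hq

theorem small_zero (ha : a ≠ 0) (ht : t ≠ 0) : Small s a t v 0 := by
  constructor <;> apply Situation.rel_of_lt
  · simpa using size_pos ha
  · simpa using pow_pos (size_pos ht) 2

theorem Small.le_sq (h : Small s a t v p) : v.size p ≤ v.size t ^ 2 := h.2.le

theorem Small.max_size (hp : Small s a t v p) (hq : Small s a t v q) {x : K}
    (hx : v.size x ≤ max (v.size p) (v.size q)) : Small s a t v x :=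
  ⟨(hp.1.max hq.1).le_trans hx, (hp.2.max hq.2).le_trans hx⟩

theorem Small.small_form {f : Polynomial K} (ht : t ≠ 0) (hd : 2 ≤ f.natDegree) (hplus : CondPlus t v)
    (hint : CondIntegral f v) (hlead : CondLeadingTerm f t v)
    (hp : Small s a t v p) (hq : Small s a t v q) : Small s a t v (form f p q) := by
  refine hp.max_size hq ((size_form_le ht hint hlead p q).trans (pow_le_of_le_one zero_le ?_ ?_))
  · exact (max_le hp.le_sq hq.le_sq).trans (pow_le_one₀ zero_le (size_le_one_of_condPlus ht hplus))
  · omega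

/-- Small elements have size at most |t|² ≤ |t|, so squaring gains the factor t that the addition
loses. -/
theorem Small.sq_add_pow (ht : t ≠ 0) (hplus : CondPlus t v) {k : ℕ} (hk : 2 ≤ k)
    (hp : Small s a t v p) (hq : Small s a t v q) : Small s a t v (p ^ 2 + q ^ k) := by
  have ht1 := size_le_one_of_condPlus ht hplus
  have ht2 : v.size t ^ 2 ≤ v.size t := pow_le_of_le_one zero_le ht1 two_ne_zero
  have ht3 : v.size t ^ 2 ≤ 1 := pow_le_one₀ zero_le ht1
  have key : ∀ y, Small s a t v y → v.size y ^ 2 ≤ v.size t * v.size y := fun y hy => by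
    rw [pow_two]
    gcongr
    exact hy.le_sq.trans ht2
  refine hp.max_size hq (le_of_mul_le_mul_left ?_ (size_pos ht))
  refine (size_add_of_condPlus ht hplus _ _).trans (max_le ?_ ?_)
  · rw [map_pow]
    exact (key p hp).trans (by gcongr; exact le_max_left _ _)
  · rw [map_pow]
    refine (pow_le_pow_of_le_one zero_le (hq.le_sq.trans ht3) hk).trans ((key q hq).trans ?_)
    gcongr
    exact le_max_right _ _

theorem Big.one_le_sq_mul (h : Big s a t v p) : 1 ≤ v.size t ^ 2 * v.size p := by
  have := h.2.le_sq
  rwa [map_inv₀, inv_le_iff_one_le_mul₀ (size_pos h.1)] at this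

theorem Big.one_lt_sq_mul (h : Big .m a t v p) : 1 < v.size t ^ 2 * v.size p := by
  have : v.size p⁻¹ < v.size t ^ 2 := h.2.2
  rwa [map_inv₀, inv_lt_iff_one_lt_mul₀ (size_pos h.1)] at this

theorem Big.le_mul_sq (ht : t ≠ 0) (hplus : CondPlus t v) (h : Big s a t v p) {k : ℕ}
    (hk : 2 ≤ k) : v.size p ≤ v.size t * v.size p ^ k := by
  have ht1 := size_le_one_of_condPlus ht hplus
  have h1 := h.one_le_sq_mul
  have h2 : 1 ≤ v.size t * v.size p := h1.trans (by
    gcongr; exact pow_le_of_le_one zero_le ht1 two_ne_zero)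
  have h3 : 1 ≤ v.size p := h2.trans (mul_le_of_le_one_left zero_le ht1)
  calc v.size p ≤ (v.size t * v.size p) * v.size p := le_mul_of_one_le_left zero_le h2
    _ = v.size t * v.size p ^ 2 := by rw [mul_assoc, pow_two]
    _ ≤ _ := by gcongr

theorem Big.one_le (ht : t ≠ 0) (hplus : CondPlus t v) (h : Big s a t v p) : 1 ≤ v.size p :=
  h.one_le_sq_mul.trans
    (mul_le_of_le_one_left zero_le (pow_le_one₀ zero_le (size_le_one_of_condPlus ht hplus)))

theorem Big.big_form {f : Polynomial K} (ht : t ≠ 0) (hd : 2 ≤ f.natDegree) (hplus : CondPlus t v)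
    (hzero : CondNoApproxZero f t v) (hlead : CondLeadingTerm f t v)
    (h : Big s a t v p ∨ Big s a t v q) : Big s a t v (form f p q) := by
  have key := le_size_form ht hplus hzero hlead p q
  rcases h with h | h
  · refine h.mono ((h.le_mul_sq ht hplus hd).trans (le_trans ?_ key))
    gcongr
    exact le_max_left _ _
  · refine h.mono ((h.le_mul_sq ht hplus hd).trans (le_trans ?_ key))
    gcongr
    exact le_max_right _ _

/-- Away from the bad exponents one summand dominates the other by more than the factor t, so no
cancellation occurs and the sum is at least t times the dominating summand. -/
theorem Big.sq_add_pow (ht : t ≠ 0) (hplus : CondPlus t v) {k : ℕ} (hk : 2 ≤ k)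
    (hk' : ¬ (v.size t * v.size p ^ 2 ≤ v.size q ^ k ∧ v.size t * v.size q ^ k ≤ v.size p ^ 2))
    (h : Big s a t v p ∨ Big s a t v q) : Big s a t v (p ^ 2 + q ^ k) := by
  have ht1 := size_le_one_of_condPlus ht hplus
  rw [not_and_or, not_le, not_le] at hk'
  rcases hk' with hk' | hk'
  · have h1 := size_mul_le_size_add ht hplus (x := q ^ k) (y := p ^ 2) (by simpa using hk')
    rw [map_pow, add_comm] at h1
    rcases h with h | h
    · exact h.mono ((h.le_mul_sq ht hplus le_rfl).trans h1)
    · exact h.mono ((le_self_pow₀ (h.one_le ht hplus) (by omega)).trans (hk'.le.trans h1))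
  · have h1 := size_mul_le_size_add ht hplus (x := p ^ 2) (y := q ^ k) (by simpa using hk')
    rw [map_pow] at h1
    rcases h with h | h
    · exact h.mono ((le_self_pow₀ (h.one_le ht hplus) two_ne_zero).trans (hk'.le.trans h1))
    · exact h.mono ((h.le_mul_sq ht hplus hk).trans h1)

/-- This is where the topology of the situation enters: an element that is big at v is big in a
neighbourhood of v. -/
theorem isOpen_setOf_big (s : Situation) (ha : a ≠ 0) (ht : t ≠ 0) (p : K) :
    @IsOpen _ s.topology {v : Locality K | Big s a t v p} := by
  by_cases hp : p = 0
  · simp [Big, hp]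
  · let := s.topology (K := K)
    have h1 := s.isOpen_setOf_rel ha p⁻¹
    have h2 := s.isOpen_setOf_rel (pow_ne_zero 2 ht) p⁻¹
    simp only [map_pow] at h2
    convert h1.inter h2 using 1
    ext v
    simp [Big, Small, hp]

end Locality

/-! ### Multiplicatively closed sets containing a unit ball, and incomparable localities -/

namespace Locality
variable {K : Type u} [Field K] {t : K} {v w : Locality K} {T : Set K}

theorem exists_valuationSubring (hv : v.ball ⊆ T) (hmul : ∀ x ∈ T, ∀ y ∈ T, x * y ∈ T)
    (hadd : ∀ x ∈ T, ∀ y ∈ T, x + y ∈ T) : ∃ A : ValuationSubring K, ∀ x, x ∈ A ↔ x ∈ T := by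
  have hneg : (-1 : K) ∈ T := hv (mem_ball.mpr (size_neg_one v).le)
  refine ⟨{ carrier := T
            mul_mem' := fun hx hy => hmul _ hx _ hy
            one_mem' := hv (mem_ball.mpr (map_one v.size).le)
            add_mem' := fun hx hy => hadd _ hx _ hy
            zero_mem' := hv (mem_ball.mpr (by simp))
            neg_mem' := fun {x} hx => by simpa using hmul _ hneg _ hx
            mem_or_inv_mem' := fun x => ?_ }, fun x => Iff.rfl⟩
  rcases le_total (v.size x) 1 with h | h
  · exact Or.inl (hv (mem_ball.mpr h))
  · exact Or.inr (hv (mem_ball.mpr (by rw [map_inv₀]; exact inv_le_one_of_one_le₀ h)))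

/-- A coarsening of `v` for which `t` is a unit is a valuation. -/
theorem exists_eq_ofValuation {u : Locality K} (ht : t ≠ 0) (hv : CondPlus t v) (hvu : v ≤ u)
    (htu : t ∈ u.units) : ∃ A : ValuationSubring K, u = ofValuation A := by
  have hadd : ∀ x y, u.size (x + y) ≤ max (u.size x) (u.size y) := by
    intro x y
    have h := size_add_of_condPlus ht hv x y
    rw [mem_units] at htu
    rw [← map_mul] at h
    rcases le_total (v.size x) (v.size y) with h' | h'
    · rw [max_eq_right h'] at h
      have := size_le_size_of_le hvu h
      rw [map_mul, htu, one_mul] at this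
      exact this.trans (le_max_right _ _)
    · rw [max_eq_left h'] at h
      have := size_le_size_of_le hvu h
      rw [map_mul, htu, one_mul] at this
      exact this.trans (le_max_left _ _)
  obtain ⟨A, hA⟩ := exists_valuationSubring (v := u) (T := u.ball) subset_rfl
    (fun x hx y hy => by rw [mem_ball] at *; rw [map_mul]; exact mul_le_one' hx hy)
    (fun x hx y hy => by rw [mem_ball] at *; exact (hadd x y).trans (max_le hx hy))
  exact ⟨A, Locality.ext (Set.ext fun x => (hA x).symm)⟩

/-- An element of `T` outside the ball has powers of unbounded absolute value, which would force `T`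
to be all of `K`, contrary to `hadd`. -/
theorem size_le_one_of_isAbsoluteValueBall (h : IsAbsoluteValueBall v.ball) (hv : v.ball ⊆ T)
    (hmul : ∀ x ∈ T, ∀ y ∈ T, x * y ∈ T) (hadd : ¬ ∀ x ∈ T, ∀ y ∈ T, x + y ∈ T) :
    T ⊆ v.ball := by
  obtain ⟨a, ha⟩ := h
  intro x hx
  by_contra hxv
  have hx1 : 1 < a x := by simpa [ha] using hxv
  have hpow : ∀ n : ℕ, x ^ n ∈ T := fun n => by
    induction n with
    | zero => simpa using hv (mem_ball.mpr (map_one v.size).le)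
    | succ n ih => rw [pow_succ]; exact hmul _ ih _ hx
  refine hadd fun y _ z _ => ?_
  obtain ⟨n, hn⟩ := pow_unbounded_of_one_lt (a (y + z)) hx1
  have hx0 : x ≠ 0 := by rintro rfl; norm_num at hx1
  have : (y + z) / x ^ n ∈ T := hv (by
    rw [ha]
    change a _ ≤ 1
    rw [map_div₀, map_pow]
    exact div_le_one_of_le₀ hn.le (by positivity))
  simpa [div_mul_cancel₀ _ (pow_ne_zero n hx0)] using hmul _ this _ (hpow n)

theorem add_mem_of_isValuationBall (h : IsValuationBall v.ball) (hv : v.ball ⊆ T)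
    (hmul : ∀ x ∈ T, ∀ y ∈ T, x * y ∈ T) : ∀ x ∈ T, ∀ y ∈ T, x + y ∈ T := by
  obtain ⟨A, hA⟩ := h
  have key : ∀ x ∈ T, ∀ y ∈ T, v.size x ≤ v.size y → x + y ∈ T := by
    intro x hx y hy hxy
    by_cases hy0 : y = 0
    · simpa [hy0] using hx
    have h1 : x / y ∈ v.ball := by
      rw [mem_ball, map_div₀]; exact div_le_one_of_le₀ hxy zero_le
    have h2 : x / y + 1 ∈ v.ball := by
      rw [hA] at h1 ⊢
      exact A.add_mem _ _ h1 A.one_mem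
    have h3 := hmul _ (hv h2) _ hy
    rwa [add_mul, one_mul, div_mul_cancel₀ _ hy0] at h3
  intro x hx y hy
  rcases le_total (v.size x) (v.size y) with h | h
  · exact key x hx y hy h
  · rw [add_comm]; exact key y hy x hx h

/-- For a valuation `T` is always additively closed, and for an absolute value a strictly larger `T`
is. Only orderings can remain. -/
theorem isOrdering_of_not_add_mem (hv : v.ball ⊆ T) (hmul : ∀ x ∈ T, ∀ y ∈ T, x * y ∈ T)
    (hadd : ¬ ∀ x ∈ T, ∀ y ∈ T, x + y ∈ T) (hT : ¬ T ⊆ v.ball) : v.IsOrdering := by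
  rcases v.isLocality with h | h | h
  · exact absurd (add_mem_of_isValuationBall h hv hmul) hadd
  · exact h
  · exact absurd (size_le_one_of_isAbsoluteValueBall h hv hmul hadd) hT

theorem IsOrdering.half_add_mem (h : v.IsOrdering) {x y : K} (hx : x ∈ v.ball) (hy : y ∈ v.ball) :
    (x + y) / 2 ∈ v.ball := by
  obtain ⟨_, _, h⟩ := h
  simp only [h, Set.mem_ofPred_eq] at *
  obtain ⟨h1, h2⟩ := hx
  obtain ⟨h3, h4⟩ := hy
  constructor <;> linarith

theorem IsOrdering.two_ne_zero (h : v.IsOrdering) : (2 : K) ≠ 0 := by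
  obtain ⟨_, _, h⟩ := h
  exact _root_.two_ne_zero

theorem IsOrdering.inv_two_mem (h : v.IsOrdering) : (2 : K)⁻¹ ∈ v.ball := by
  simpa using h.half_add_mem (x := 1) (y := 0) (by simp [mem_ball]) (by simp [mem_ball])

theorem IsOrdering.half_add_mem_of_ball_subset (h : v.IsOrdering) (hv : v.ball ⊆ T)
    (hmul : ∀ x ∈ T, ∀ y ∈ T, x * y ∈ T) : ∀ x ∈ T, ∀ y ∈ T, (x + y) / 2 ∈ T := by
  have key : ∀ x ∈ T, ∀ y ∈ T, v.size x ≤ v.size y → (x + y) / 2 ∈ T := by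
    intro x hx y hy hxy
    by_cases hy0 : y = 0
    · simpa [hy0, div_eq_mul_inv] using hmul _ hx _ (hv h.inv_two_mem)
    have h1 : x / y ∈ v.ball := by
      rw [mem_ball, map_div₀]; exact div_le_one_of_le₀ hxy zero_le
    have h3 := hmul _ (hv (h.half_add_mem h1 (y := 1) (by simp [mem_ball]))) _ hy
    rwa [div_mul_eq_mul_div, add_mul, one_mul, div_mul_cancel₀ _ hy0] at h3
  intro x hx y hy
  rcases le_total (v.size x) (v.size y) with h | h
  · exact key x hx y hy h
  · rw [add_comm]; exact key y hy x hx h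

/-- Elements all of whose powers are bounded by `2` are infinitesimally close to the unit ball. -/
theorem IsOrdering.exists_infinitesimal_sub (h : v.IsOrdering) {x : K}
    (hx : ∀ n : ℕ, 2 * (x ^ n)⁻¹ ∉ v.ball) :
    ∃ y ∈ v.ball, ∀ n : ℕ, 2 ^ n * (x - y) ∈ v.ball := by
  by_cases hxv : x ∈ v.ball
  · exact ⟨x, hxv, fun n => by simp [mem_ball]⟩
  obtain ⟨_, _, h⟩ := h
  simp only [h, Set.mem_ofPred_eq, ← abs_le, not_le] at *
  have hpow : ∀ n : ℕ, |x| ^ n < 2 := fun n => by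
    have := hx n
    rwa [abs_mul, abs_inv, abs_pow, abs_two, ← div_eq_mul_inv, one_lt_div₀ (by positivity)] at this
  -- Bernoulli's inequality with exponent 2^n turns the bound on powers into infinitesimality of |x|
  -- - 1.
  have hlt : ∀ n : ℕ, 2 ^ n * (|x| - 1) ≤ 1 := fun n => by
    have h1 := one_add_mul_le_pow (a := |x| - 1) (by linarith) (2 ^ n)
    rw [add_sub_cancel] at h1
    push_cast at h1
    linarith [hpow (2 ^ n)]
  rcases le_total 0 x with h0 | h0
  · rw [abs_of_nonneg h0] at hlt hxv
    refine ⟨1, by simp, fun n => ?_⟩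
    rw [abs_of_nonneg (by have := sub_nonneg.mpr hxv.le; positivity)]
    exact hlt n
  · rw [abs_of_nonpos h0] at hlt hxv
    refine ⟨-1, by simp, fun n => ?_⟩
    rw [abs_mul, abs_of_nonneg (by positivity), abs_of_nonpos (by linarith)]
    convert hlt n using 2
    ring

/-- `A` is the union of the sets 2^n T. It is closed under addition because `T` is closed under (x +
y)/2. If z is infinitesimal with respect to `T` and z⁻¹ lay in 2^n T, multiplying would put 2 into
`T`. -/
theorem exists_valuationSubring_of_isOrdering (h : v.IsOrdering) (hv : v.ball ⊆ T)
    (hmul : ∀ x ∈ T, ∀ y ∈ T, x * y ∈ T) (h2 : (2 : K) ∉ T) :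
    ∃ A : ValuationSubring K, T ⊆ {x | x ∈ A} ∧
      ∀ z, (∀ n : ℕ, 2 ^ n * z ∈ T) → z ≠ 0 → z⁻¹ ∉ A := by
  have h20 := h.two_ne_zero
  have hshift : ∀ x (n m : ℕ), x / 2 ^ n ∈ T → x / 2 ^ (n + m) ∈ T := by
    intro x n m hx
    induction m with
    | zero => exact hx
    | succ m ih =>
      have := hmul _ ih _ (hv h.inv_two_mem)
      rwa [← div_eq_mul_inv, div_div, ← pow_succ] at this
  have hhalf := h.half_add_mem_of_ball_subset hv hmul
  obtain ⟨A, hA⟩ := exists_valuationSubring (v := v) (T := {x | ∃ n : ℕ, x / 2 ^ n ∈ T})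
    (fun x hx => ⟨0, by simpa using hv hx⟩)
    (by
      rintro x ⟨n, hx⟩ y ⟨m, hy⟩
      refine ⟨n + m, ?_⟩
      rw [pow_add, ← div_mul_div_comm]
      exact hmul _ hx _ hy)
    (by
      rintro x ⟨n, hx⟩ y ⟨m, hy⟩
      refine ⟨n + m + 1, ?_⟩
      have := hhalf _ (hshift x n m hx) _ (hshift y m n hy)
      rwa [add_comm m n, ← add_div, div_div, ← pow_succ] at this)
  refine ⟨A, fun x hx => (hA x).mpr ⟨0, by simpa using hx⟩, fun z hz hz0 hzA => h2 ?_⟩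
  obtain ⟨n, hn⟩ := (hA _).mp hzA
  have := hmul _ hn _ (hz (n + 1))
  have h2n : (2 : K) ^ n ≠ 0 := pow_ne_zero n h20
  convert this using 1
  field_simp
  ring

theorem residueBall_le {A : ValuationSubring K} (hw : w ≤ ofValuation A)
    (h : ∀ x ∈ v.ball, ∃ y ∈ w.ball, x - y ≠ 0 → (x - y)⁻¹ ∉ A) :
    residueBall v A ⊆ residueBall w A := by
  rintro _ ⟨⟨x, hxA⟩, hx, rfl⟩
  obtain ⟨y, hy, hxy⟩ := h x hx
  have hyA : y ∈ A := hw hy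
  refine ⟨⟨y, hyA⟩, hy, ?_⟩
  rw [← sub_eq_zero, ← map_sub, IsLocalRing.residue_eq_zero_iff, IsLocalRing.mem_maximalIdeal,
    mem_nonunits_iff, A.valuation_eq_one_iff]
  intro h2
  change A.valuation (y - x) = 1 at h2
  by_cases h0 : x - y = 0
  · rw [← neg_sub, h0] at h2
    simp at h2
  · refine hxy h0 ((A.valuation_le_one_iff _).mp ?_)
    rw [map_inv₀, ← neg_sub, Valuation.map_neg, h2, inv_one]

/-- Approximation at two incomparable localities with prescribed precision in the units of their
finest common coarsening. -/
theorem exists_lt_and_lt_of_incomparable (hvw : Incomparable v w) {A : ValuationSubring K}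
    (hA : IsLUB {v, w} (ofValuation A))
    (hstr : v.IsOrdering → w.IsOrdering → StronglyIncomparable v w) {a c : K}
    (ha : (ofValuation A).size a = 1) (hc : (ofValuation A).size c = 1) :
    ∃ x, v.size x < v.size a ∧ w.size c < w.size x := by
  by_contra! h
  have hvA : v ≤ ofValuation A := hA.1 (by simp)
  have hwA : w ≤ ofValuation A := hA.1 (by simp)
  -- `M` is the largest 𝒪_v-stable set inside c𝒪_w, and it is 𝒪_w-stable too. Its multipliers `T`
  -- therefore contain both unit balls and are closed under multiplication.
  let M : Set K := {x | ∀ r ∈ v.ball, w.size (r * x) ≤ w.size c}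
  let T : Set K := {x | ∀ m ∈ M, x * m ∈ M}
  have hvT : v.ball ⊆ T := fun x hx m hm r hr => by
    rw [← mul_assoc]
    refine hm _ ?_
    rw [mem_ball] at *
    rw [map_mul]
    exact mul_le_one' hr hx
  have hwT : w.ball ⊆ T := fun x hx m hm r hr => by
    rw [mul_left_comm, map_mul]
    exact (mul_le_of_le_one_left zero_le (mem_ball.mp hx)).trans (hm r hr)
  have hmul : ∀ x ∈ T, ∀ y ∈ T, x * y ∈ T := fun x hx y hy m hm => by
    rw [mul_assoc]
    exact hx _ (hy _ hm)
  have hTadd : ¬ ∀ x ∈ T, ∀ y ∈ T, x + y ∈ T := by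
    intro hadd
    obtain ⟨A', hA'⟩ := exists_valuationSubring hvT hmul hadd
    have hAA' : ofValuation A ≤ ofValuation A' := hA.2 (by
      rintro u (rfl | rfl)
      · exact fun x hx => (hA' x).mpr (hvT hx)
      · exact fun x hx => (hA' x).mpr (hwT hx))
    -- Such an x is a unit of `A`, and dividing a by it gives a unit of `A` that lies in `M`. As `A`
    -- is contained in `T`, it follows that cA ⊆ M ⊆ c𝒪_w, so w would coarsen v.
    obtain ⟨x, hx, hxv⟩ : ∃ x, (ofValuation A).size x ≤ 1 ∧ 1 < v.size x := by
      by_contra! hcon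
      exact hvw.2 (hwA.trans (le_iff.mpr hcon))
    have hx1 : (ofValuation A).size x = 1 := by
      refine le_antisymm hx (le_of_not_gt fun h1 => hxv.not_gt ?_)
      simpa using size_lt_size_of_le hvA (x := x) (y := 1) (by simpa using h1)
    have haM : a * x⁻¹ ∈ M := fun r hr => by
      refine h _ ?_
      rw [mem_ball] at hr
      have ha0 : a ≠ 0 := by rintro rfl; simp at ha
      calc v.size (r * (a * x⁻¹)) ≤ v.size (a * x⁻¹) := by
            rw [map_mul]; exact mul_le_of_le_one_left zero_le hr
        _ < v.size a := by
            rw [map_mul, map_inv₀]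
            exact mul_lt_of_lt_one_right (size_pos ha0) (inv_lt_one_of_one_lt₀ hxv)
    have hxa : (ofValuation A).size (a * x⁻¹) = 1 := by rw [map_mul, map_inv₀, ha, hx1]; simp
    have hxa0 : a * x⁻¹ ≠ 0 := by intro h0; rw [h0] at hxa; simp at hxa
    have hc0 : c ≠ 0 := by rintro rfl; simp at hc
    refine hvw.1 (hvA.trans (le_iff.mpr fun y hy => ?_))
    have hyT : y * c / (a * x⁻¹) ∈ T := (hA' _).mp (hAA' (mem_ball.mpr (by
      rw [map_div₀, map_mul, hc, hxa]; simpa using hy)))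
    have hyM := hyT _ haM 1 (by simp [mem_ball])
    rw [div_mul_cancel₀ _ hxa0, one_mul, map_mul] at hyM
    exact (mul_le_iff_le_one_left (size_pos hc0)).mp hyM
  have hv := isOrdering_of_not_add_mem hvT hmul hTadd fun h' => hvw.2 (hwT.trans h')
  have hw := isOrdering_of_not_add_mem hwT hmul hTadd fun h' => hvw.1 (hvT.trans h')
  have h2 : (2 : K) ∉ T := by
    refine fun h2 => hTadd fun x hx y hy => ?_
    simpa [mul_div_cancel₀ _ hv.two_ne_zero] using
      hmul _ h2 _ (hv.half_add_mem_of_ball_subset hvT hmul x hx y hy)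
  obtain ⟨-, B, hB, hne⟩ := hstr hv hw
  obtain ⟨C, hTC, hC⟩ := exists_valuationSubring_of_isOrdering hv hvT hmul h2
  have hBC : ofValuation B ≤ ofValuation C := hB.2 (by
    rintro u (rfl | rfl)
    exacts [hvT.trans hTC, hwT.trans hTC])
  -- All powers of x lie in `T` but 2 does not, so the powers of x stay below 2 in the ordering u.
  -- Hence x is infinitesimally close to 𝒪_u, that is, congruent to an element of 𝒪_u modulo the
  -- maximal ideal of `B`. So v and w have the same residue ball.
  have key : ∀ u : Locality K, u.IsOrdering → u.ball ⊆ T → ∀ x ∈ T,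
      ∃ y ∈ u.ball, x - y ≠ 0 → (x - y)⁻¹ ∉ B := by
    intro u hu huT x hx
    have hpow : ∀ n : ℕ, x ^ n ∈ T := fun n => by
      induction n with
      | zero => simpa using hvT (mem_ball.mpr (map_one v.size).le)
      | succ n ih => rw [pow_succ]; exact hmul _ ih _ hx
    obtain rfl | hx0 := eq_or_ne x 0
    · exact ⟨0, by simp [mem_ball], by simp⟩
    obtain ⟨y, hy, hxy⟩ := hu.exists_infinitesimal_sub (x := x) fun n hn => h2 (by
      simpa [mul_assoc, inv_mul_cancel₀ (pow_ne_zero n hx0)] using hmul _ (huT hn) _ (hpow n))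
    exact ⟨y, hy, fun h0 h1 => hC _ (fun n => huT (hxy n)) h0 (hBC h1)⟩
  exact hne (Set.Subset.antisymm
    (residueBall_le (hB.1 (by simp)) fun x hx => key w hw hwT x (hvT hx))
    (residueBall_le (hB.1 (by simp)) fun x hx => key v hv hvT x (hwT hx)))

end Locality

/-! ### Separation of two localities -/

namespace Locality
variable {K : Type u} [Field K] {t a b : K} {v w : Locality K} {s s' : Situation}

theorem exists_unit_size_lt (hvw : ¬ w ≤ v) (hv : v ≤ w) :
    ∃ x, w.size x = 1 ∧ v.size x < 1 := by
  obtain ⟨x, hx, hxv⟩ : ∃ x, w.size x ≤ 1 ∧ 1 < v.size x := by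
    by_contra! hcon
    exact hvw (le_iff.mpr hcon)
  have hx1 : w.size x = 1 := by
    refine le_antisymm hx (le_of_not_gt fun h1 => hxv.not_gt ?_)
    simpa using size_lt_size_of_le hv (x := x) (y := 1) (by simpa using h1)
  exact ⟨x⁻¹, by simp [hx1], by rw [map_inv₀]; exact inv_lt_one_of_one_lt₀ hxv⟩

theorem TIndependent.symm (h : TIndependent t v w) : TIndependent t w v := by
  obtain ⟨⟨u, hu, htu⟩, h2⟩ := h
  refine ⟨⟨u, by rwa [Set.pair_comm], htu⟩, fun h3 h4 => ?_⟩
  obtain ⟨h5, A, hA, hne⟩ := h2 h4 h3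
  exact ⟨⟨h5.2, h5.1⟩, A, by rwa [Set.pair_comm], hne.symm⟩

theorem TIndependent.valuation_eq_one (h : TIndependent t v w) {A : ValuationSubring K}
    (hv : v ≤ ofValuation A) (hw : w ≤ ofValuation A) : (ofValuation A).size t = 1 := by
  obtain ⟨⟨u, hu, htu⟩, -⟩ := h
  have huA : u ≤ ofValuation A := hu.2 (by rintro _ (rfl | rfl) <;> assumption)
  rw [mem_units] at htu
  refine le_antisymm ?_ ?_
  · simpa using size_le_size_of_le huA (x := t) (y := 1) (by simp [htu])
  · simpa using size_le_size_of_le huA (x := 1) (y := t) (by simp [htu])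

theorem TIndependent.exists_eq_ofValuation_of_le (ht : t ≠ 0) (hw : CondPlus t w)
    (h : TIndependent t v w) (hvw : v ≤ w) : ∃ A : ValuationSubring K, w = ofValuation A := by
  obtain ⟨⟨u, hu, htu⟩, -⟩ := h
  have huw : u = w := le_antisymm (hu.2 (by rintro _ (rfl | rfl); exacts [hvw, le_rfl]))
    (hu.1 (by simp))
  exact exists_eq_ofValuation ht hw le_rfl (huw ▸ htu)

theorem exists_size_le_both (v : Locality K) (a t : K) :
    ∃ a', v.size a' ≤ v.size a ∧ v.size a' ≤ v.size t ^ 2 ∧ (a' = a ∨ a' = t ^ 2) := by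
  rcases le_total (v.size a) (v.size t ^ 2) with h | h
  · exact ⟨a, le_rfl, h, Or.inl rfl⟩
  · exact ⟨t ^ 2, by rwa [map_pow], (map_pow _ _ _).le, Or.inr rfl⟩

/-- Here w is itself the finest common coarsening, hence a valuation, and `h2` leaves only the
non-strict condition at w. The smaller of a and t² at v serves as y; in Situation 𝔪 it is multiplied
by a w-unit lying in 𝔪_v to make the inequality strict. -/
theorem exists_small_of_le (ht : t ≠ 0) (hw : CondPlus t w)
    (hind : TIndependent t v w) (h1 : s = .m → ¬ w ≤ v) (h2 : s' = .m → ¬ v ≤ w)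
    (hab : ∀ A : ValuationSubring K, v ≤ ofValuation A → w ≤ ofValuation A →
      1 ≤ (ofValuation A).size a ∧ 1 ≤ (ofValuation A).size b) (hvw : v ≤ w) :
    ∃ y ≠ 0, Small s a t v y ∧ Small s' b t w y⁻¹ := by
  obtain ⟨A, rfl⟩ := hind.exists_eq_ofValuation_of_le ht hw hvw
  obtain ⟨ha, hb⟩ := hab A hvw le_rfl
  have ht1 := hind.valuation_eq_one hvw le_rfl
  obtain ⟨a', ha1, ha2, ha3⟩ := exists_size_le_both v a t
  have haA : 1 ≤ (ofValuation A).size a' := by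
    rcases ha3 with rfl | rfl
    · exact ha
    · simp [ht1]
  have ha0 : a' ≠ 0 := by
    rintro rfl
    simp at haA
  have hs' : s' = .O := by
    cases s'
    · exact absurd hvw (h2 rfl)
    · rfl
  obtain ⟨p, hp, hps⟩ : ∃ p, (ofValuation A).size p = 1 ∧ s.Rel (v.size (p * a')) (v.size a') := by
    cases s
    · obtain ⟨p, hp, hpv⟩ := exists_unit_size_lt (h1 rfl) hvw
      exact ⟨p, hp, by rw [map_mul]; exact mul_lt_of_lt_one_left (size_pos ha0) hpv⟩
    · exact ⟨1, map_one _, by rw [one_mul]; exact le_refl (v.size a')⟩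
  have hp0 : p ≠ 0 := by
    rintro rfl
    simp at hp
  have hpa : (ofValuation A).size (p * a')⁻¹ ≤ 1 := by
    rw [map_inv₀, map_mul, hp, one_mul]
    exact inv_le_one_of_one_le₀ haA
  subst hs'
  refine ⟨p * a', mul_ne_zero hp0 ha0, ⟨hps.trans_le ha1, hps.trans_le ha2⟩, hpa.trans hb, ?_⟩
  rw [ht1, one_pow]
  exact hpa

theorem exists_small_of_incomparable (ht : t ≠ 0) (hv : CondPlus t v)
    (hind : TIndependent t v w)
    (hab : ∀ A : ValuationSubring K, v ≤ ofValuation A → w ≤ ofValuation A →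
      1 ≤ (ofValuation A).size a ∧ 1 ≤ (ofValuation A).size b) (hvw : Incomparable v w) :
    ∃ y ≠ 0, Small s a t v y ∧ Small s' b t w y⁻¹ := by
  obtain ⟨A, hA, hstr⟩ : ∃ A : ValuationSubring K, IsLUB {v, w} (ofValuation A) ∧
      (v.IsOrdering → w.IsOrdering → StronglyIncomparable v w) := by
    obtain ⟨⟨u, hu, htu⟩, h⟩ := hind
    obtain ⟨A, rfl⟩ := exists_eq_ofValuation ht hv (hu.1 (by simp)) htu
    exact ⟨A, hu, h⟩
  have hvA : v ≤ ofValuation A := hA.1 (by simp)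
  have hwA : w ≤ ofValuation A := hA.1 (by simp)
  obtain ⟨ha, hb⟩ := hab A hvA hwA
  have ht1 := hind.valuation_eq_one hvA hwA
  have key : ∀ (u : Locality K) (a : K), u ≤ ofValuation A → 1 ≤ (ofValuation A).size a →
      ∃ a', (ofValuation A).size a' = 1 ∧ u.size a' ≤ u.size a ∧ u.size a' ≤ u.size t ^ 2 := by
    intro u a hu ha
    obtain ⟨a', ha1, ha2, ha3⟩ := exists_size_le_both u a t
    have haA : 1 ≤ (ofValuation A).size a' := by
      rcases ha3 with rfl | rfl
      · exact ha
      · simp [ht1]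
    -- The precision has to be a unit of `A`. If a' has size greater than 1 at `A`, then 1 is
    -- already smaller than a' at u and can replace it.
    rcases haA.eq_or_lt with h | h
    · exact ⟨a', h.symm, ha1, ha2⟩
    · have : u.size 1 ≤ u.size a' := (size_lt_size_of_le hu (by simpa using h)).le
      exact ⟨1, map_one _, this.trans ha1, this.trans ha2⟩
  obtain ⟨a', ha1, ha2, ha3⟩ := key v a hvA ha
  obtain ⟨b', hb1, hb2, hb3⟩ := key w b hwA hb
  obtain ⟨x, hx1, hx2⟩ := exists_lt_and_lt_of_incomparable hvw hA hstr ha1 (c := b'⁻¹)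
    (by simp [hb1])
  have hb0 : b' ≠ 0 := by
    rintro rfl
    simp at hb1
  have hx0 : x ≠ 0 := by
    rintro rfl
    simp at hx2
  have hx3 : w.size x⁻¹ < w.size b' := by
    rw [map_inv₀] at hx2 ⊢
    exact inv_lt_of_inv_lt₀ (size_pos hb0) hx2
  exact ⟨x, hx0, ⟨Situation.rel_of_lt (hx1.trans_le ha2), Situation.rel_of_lt (hx1.trans_le ha3)⟩,
    Situation.rel_of_lt (hx3.trans_le hb2), Situation.rel_of_lt (hx3.trans_le hb3)⟩

/-- Separation of two localities. -/
theorem exists_small_and_big (ht : t ≠ 0) (hv : CondPlus t v) (hw : CondPlus t w)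
    (hind : TIndependent t v w) (h1 : s = .m → ¬ w ≤ v) (h2 : s' = .m → ¬ v ≤ w)
    (hab : ∀ A : ValuationSubring K, v ≤ ofValuation A → w ≤ ofValuation A →
      1 ≤ (ofValuation A).size a ∧ 1 ≤ (ofValuation A).size b) :
    ∃ y ≠ 0, Small s a t v y ∧ Big s' b t w y := by
  suffices h : ∃ y ≠ 0, Small s a t v y ∧ Small s' b t w y⁻¹ by
    obtain ⟨y, h0, h1, h2⟩ := h
    exact ⟨y, h0, h1, h0, h2⟩
  by_cases hvw : v ≤ w
  · exact exists_small_of_le ht hw hind h1 h2 hab hvw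
  by_cases hwv : w ≤ v
  · obtain ⟨y, h0, h3, h4⟩ := exists_small_of_le ht hv hind.symm h2 h1
      (fun A h3 h4 => (hab A h4 h3).symm) hwv
    exact ⟨y⁻¹, inv_ne_zero h0, h4, by rwa [inv_inv]⟩
  · exact exists_small_of_incomparable ht hv hind hab ⟨hvw, hwv⟩

end Locality

/-! ### From separating elements to approximate idempotents -/

namespace Locality
variable {K : Type u} [Field K] {t a y : K} {v : Locality K} {s : Situation} {f : Polynomial K}

theorem rel_add (ht : t ≠ 0) (hplus : CondPlus t v) {p q z : K}
    (hp : s.Rel (v.size p) (v.size (t * z))) (hq : s.Rel (v.size q) (v.size (t * z))) :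
    s.Rel (v.size (p + q)) (v.size z) := by
  have := (hp.max hq).le_trans (size_add_of_condPlus ht hplus p q)
  rw [map_mul] at this
  exact this.of_mul_left (size_pos ht)

theorem rel_of_rel_mul (ht : t ≠ 0) (hplus : CondPlus t v) {p z : K}
    (hp : s.Rel (v.size p) (v.size (t * z))) : s.Rel (v.size p) (v.size z) := by
  refine hp.trans_le ?_
  rw [map_mul]
  exact mul_le_of_le_one_left zero_le (size_le_one_of_condPlus ht hplus)

theorem form_one_left (hy : y ≠ 0) : form f 1 y = y ^ f.natDegree * f.eval y⁻¹ := by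
  rw [form, if_neg hy, one_div]

/-- For small y, y^d f(y⁻¹) differs from the leading coefficient by at most |y| and has size at
least |t|, by the condition on f at y⁻¹ ∉ 𝒪_v. -/
theorem Small.rel_one_sub_div_form (ht : t ≠ 0) (hd : 2 ≤ f.natDegree) (hplus : CondPlus t v)
    (hlead : CondLeadingTerm f t v) (hint : CondIntegral f v)
    (hzero : s = .m ∨ CondNoApproxZero f t v)
    (hy : y ≠ 0) (h : Small s (t ^ 2 * a) t v y) :
    s.Rel (v.size (1 - f.leadingCoeff / form f 1 y)) (v.size a) := by
  have ht1 := size_le_one_of_condPlus ht hplus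
  have htt : v.size t ^ 2 ≤ v.size t := pow_le_of_le_one zero_le ht1 two_ne_zero
  have hya : s.Rel (v.size y) (v.size t * v.size a) := h.1.trans_le (by
    rw [map_mul, map_pow]
    gcongr)
  have hyd : y ^ f.natDegree ≠ 0 := pow_ne_zero _ hy
  rw [form_one_left hy]
  -- The condition on leading terms says nothing when y⁻¹ ∈ 𝒪_v. For small y this happens only in
  -- Situation 𝒪 with |t| = |y| = 1; then 1 ≤ |a| and crude bounds suffice.
  rcases le_or_gt (v.size y⁻¹) 1 with h1 | h1
  · have hy1 : 1 ≤ v.size y := by rwa [map_inv₀, inv_le_one₀ (size_pos hy)] at h1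
    have hs : s = .O := by
      cases s
      · exact absurd ((hy1.trans_lt h.2).trans_le (htt.trans ht1)) (lt_irrefl _)
      · rfl
    subst hs
    have hzero : CondNoApproxZero f t v := by simpa using hzero
    have ht2 : v.size t = 1 := le_antisymm ht1 (hy1.trans (h.le_sq.trans htt))
    have hy2 : v.size y = 1 := le_antisymm (h.le_sq.trans (htt.trans ht1)) hy1
    have hf : v.size (f.eval y⁻¹) = 1 := le_antisymm (condIntegral_size hint h1)
      (ht2 ▸ condNoApproxZero_size ht hzero h1)
    have hlc := size_leadingCoeff_le ht hplus hlead
    rw [ht2, one_mul] at hlc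
    have := size_add_of_condPlus ht hplus 1 (-(f.leadingCoeff / (y ^ f.natDegree * f.eval y⁻¹)))
    rw [ht2, one_mul, ← sub_eq_add_neg, size_neg, map_div₀, map_mul, map_pow, hy2, hf] at this
    have ha : v.size y ≤ v.size t * v.size a := hya
    rw [ht2, one_mul] at ha
    change v.size _ ≤ v.size a
    refine this.trans (le_trans (max_le (by simp) ?_) (hy1.trans ha))
    simpa using hlc
  · obtain ⟨-, h2, h3⟩ := condLeadingTerm_size ht hlead h1
    have hf0 : f.eval y⁻¹ ≠ 0 := by
      intro h0
      rw [h0, map_zero, le_zero_iff] at h2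
      exact mul_ne_zero (size_pos ht).ne' (pow_pos (zero_lt_one.trans h1) _).ne' h2
    have hF : v.size t ≤ v.size (y ^ f.natDegree * f.eval y⁻¹) := by
      calc v.size t = v.size y ^ f.natDegree * (v.size t * v.size y⁻¹ ^ f.natDegree) := by
            rw [mul_left_comm, ← mul_pow, ← map_mul, mul_inv_cancel₀ hy, map_one, one_pow, mul_one]
        _ ≤ _ := by rw [map_mul, map_pow]; gcongr
    have hnum : v.size (y ^ f.natDegree * (f.eval y⁻¹ - f.leadingCoeff * y⁻¹ ^ f.natDegree))
        ≤ v.size y := by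
      obtain ⟨k, hk⟩ : ∃ k, f.natDegree = k + 1 := ⟨f.natDegree - 1, by omega⟩
      calc _ ≤ v.size y ^ f.natDegree * v.size y⁻¹ ^ (f.natDegree - 1) := by
            rw [map_mul, map_pow]; gcongr
        _ = v.size y := by
            rw [hk, Nat.add_sub_cancel, pow_succ', mul_assoc, ← mul_pow, ← map_mul,
              mul_inv_cancel₀ hy, map_one, one_pow, mul_one]
    have heq : 1 - f.leadingCoeff / (y ^ f.natDegree * f.eval y⁻¹) =
        y ^ f.natDegree * (f.eval y⁻¹ - f.leadingCoeff * y⁻¹ ^ f.natDegree) /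
          (y ^ f.natDegree * f.eval y⁻¹) := by
      rw [mul_sub, mul_left_comm _ f.leadingCoeff, ← mul_pow, mul_inv_cancel₀ hy, one_pow, mul_one,
        sub_div, div_self (mul_ne_zero hyd hf0)]
    refine Situation.Rel.of_mul_left (size_pos ht) (hya.le_trans ?_)
    rw [heq, map_div₀]
    calc _ ≤ v.size (y ^ f.natDegree * f.eval y⁻¹) * (_ / v.size (y ^ f.natDegree * f.eval y⁻¹)) :=
          mul_le_mul_left hF _
      _ = _ := mul_div_cancel₀ _ ((size_pos (mul_ne_zero hyd hf0)).ne')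
      _ ≤ _ := hnum

theorem Big.rel_div_form (ht : t ≠ 0) (hd : 2 ≤ f.natDegree) (hplus : CondPlus t v)
    (hlead : CondLeadingTerm f t v) (hzero : CondNoApproxZero f t v)
    (h : Big s (t ^ 2 * a) t v y) : s.Rel (v.size (f.leadingCoeff / form f 1 y)) (v.size a) := by
  have hF : v.size t * v.size y ≤ v.size (form f 1 y) := by
    refine le_trans ?_ (le_size_form ht hplus hzero hlead 1 y)
    gcongr
    refine (le_self_pow₀ (h.one_le ht hplus) (by omega : f.natDegree ≠ 0)).trans ?_
    gcongr
    exact le_max_right _ _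
  have h1 : s.Rel (v.size y⁻¹) (v.size t ^ 2 * v.size a) := by
    have := h.2.1
    rwa [map_mul, map_pow] at this
  refine Situation.Rel.of_mul_left (pow_pos (size_pos ht) 2) (h1.le_trans ?_)
  have hF0 : 0 < v.size t * v.size y := mul_pos (size_pos ht) (size_pos h.1)
  calc _ = v.size t * (v.size t * v.size f.leadingCoeff) * (v.size (form f 1 y))⁻¹ := by
        rw [map_div₀, pow_two, div_eq_mul_inv]; simp only [mul_assoc]
    _ ≤ v.size t * 1 * (v.size t * v.size y)⁻¹ := by
        gcongr
        exact size_leadingCoeff_le ht hplus hlead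
    _ = v.size y⁻¹ := by
        rw [mul_one, mul_inv, mul_inv_cancel_left₀ (size_pos ht).ne', map_inv₀]

theorem Small.rel_one_sub_inv (ht : t ≠ 0) (hplus : CondPlus t v)
    (h : Small .m (t ^ 2 * a) t v y) :
    Situation.m.Rel (v.size (1 - (1 + y)⁻¹)) (v.size a) := by
  have ht1 := size_le_one_of_condPlus ht hplus
  have htt : v.size t ^ 2 ≤ v.size t := pow_le_of_le_one zero_le ht1 two_ne_zero
  have hF : v.size t ≤ v.size (1 + y) := by
    have := size_mul_le_size_add ht hplus (x := y) (y := 1) (by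
      rw [map_one, mul_one]
      exact lt_of_lt_of_le h.2 htt)
    rwa [map_one, mul_one, add_comm] at this
  have h0 : 1 + y ≠ 0 := by
    intro h0
    rw [h0, map_zero] at hF
    exact (size_pos ht).not_ge hF
  have h1 : Situation.m.Rel (v.size y) (v.size t * v.size a) := h.1.trans_le (by
    rw [map_mul, map_pow]
    gcongr)
  refine h1.le_trans ?_ |>.of_mul_left (size_pos ht)
  calc _ ≤ v.size (1 + y) * v.size (1 - (1 + y)⁻¹) := by gcongr
    _ = v.size y := by rw [← map_mul, mul_sub, mul_inv_cancel₀ h0, mul_one, add_sub_cancel_left]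

theorem Big.rel_inv (ht : t ≠ 0) (hplus : CondPlus t v)
    (h : Big .m (t ^ 2 * a) t v y) : Situation.m.Rel (v.size (1 + y)⁻¹) (v.size a) := by
  have ht1 := size_le_one_of_condPlus ht hplus
  have htt : v.size t ^ 2 ≤ v.size t := pow_le_of_le_one zero_le ht1 two_ne_zero
  have hF : v.size t * v.size y ≤ v.size (1 + y) := by
    refine size_mul_le_size_add ht hplus ?_
    rw [map_one]
    exact h.one_lt_sq_mul.trans_le (by gcongr)
  have h1 : Situation.m.Rel (v.size y⁻¹) (v.size t * v.size a) := h.2.1.trans_le (by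
    rw [map_mul, map_pow]
    gcongr)
  refine h1.le_trans ?_ |>.of_mul_left (size_pos ht)
  have hF0 : 0 < v.size t * v.size y := mul_pos (size_pos ht) (size_pos h.1)
  calc _ ≤ v.size t * (v.size t * v.size y)⁻¹ := by rw [map_inv₀]; gcongr
    _ = v.size y⁻¹ := by rw [mul_inv, mul_inv_cancel_left₀ (size_pos ht).ne', map_inv₀]

end Locality

/-! ### Families of localities -/

namespace Locality
variable {K : Type u} [Field K] {n : ℕ}

/-- Families of localities with a common polynomial, `σ i` being the situation considered on
`S i`. -/
structure IsAdmissible (s : Situation) (f : Polynomial K) (t : K) (S : Fin n → Set (Locality K))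
    (σ : Fin n → Situation) : Prop where
  ne_zero : t ≠ 0
  two_le_natDegree : 2 ≤ f.natDegree
  integral : ∀ i, ∀ v ∈ S i, CondIntegral f v
  leading : ∀ i, ∀ v ∈ S i, CondLeadingTerm f t v
  plus : ∀ i, ∀ v ∈ S i, CondPlus t v
  indep : ∀ i j, i ≠ j → ∀ v ∈ S i, ∀ w ∈ S j, TIndependent t v w
  not_le : ∀ i j, i ≠ j → ∀ v ∈ S i, ∀ w ∈ S j, σ i = .m → ¬ w ≤ v

/-- All members of the family with index in `J` are finite. -/
def FiniteOn (S : Fin n → Set (Locality K)) (σ : Fin n → Situation) (J : Finset (Fin n)) : Prop :=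
  ∀ j ∈ J, σ j = .m ∧ (S j).Finite

/-- All members of the family with index in `J` are compact and `f` has no approximate zeros. -/
def CompactOn (s : Situation) (f : Polynomial K) (t : K) (S : Fin n → Set (Locality K))
    (σ : Fin n → Situation) (J : Finset (Fin n)) : Prop :=
  ∀ j ∈ J, σ j = s ∧ @IsCompact _ s.topology (S j) ∧ ∀ v ∈ S j, CondNoApproxZero f t v

variable {s : Situation} {f : Polynomial K} {t : K} {S : Fin n → Set (Locality K)}
  {σ : Fin n → Situation} {I J : Finset (Fin n)} {R : K → Prop} {a b : Fin n → K}

/-- `R` stands for any property stable under `form`, later smallness elsewhere. An element big at v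
is big near v, and `form` merges finitely many such elements. -/
theorem exists_big_of_compactOn (hS : IsAdmissible s f t S σ) (hJ : CompactOn s f t S σ J)
    (hR0 : R 0) (hR : ∀ p q, R p → R q → R (form f p q)) (hb : ∀ j, b j ≠ 0)
    (h : ∀ j ∈ J, ∀ v ∈ S j, ∃ p, R p ∧ Big (σ j) (b j) t v p) :
    ∃ p, R p ∧ ∀ j ∈ J, ∀ v ∈ S j, Big (σ j) (b j) t v p := by
  classical
  have hbig : ∀ j ∈ J, ∀ v ∈ S j, ∀ p q, Big (σ j) (b j) t v p ∨ Big (σ j) (b j) t v q →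
      Big (σ j) (b j) t v (form f p q) := fun j hj v hv p q hpq =>
    Big.big_form hS.ne_zero hS.two_le_natDegree (hS.plus j v hv) ((hJ j hj).2.2 v hv)
      (hS.leading j v hv) hpq
  suffices H : ∀ I ⊆ J, ∃ p, R p ∧ ∀ j ∈ I, ∀ v ∈ S j, Big (σ j) (b j) t v p from H J subset_rfl
  intro I
  induction I using Finset.induction_on with
  | empty => exact fun _ => ⟨0, hR0, by simp⟩
  | insert i I _ ih =>
    intro hI
    obtain ⟨p, hp, hpI⟩ := ih fun j hj => hI (Finset.mem_insert_of_mem hj)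
    have hi : i ∈ J := hI (Finset.mem_insert_self _ _)
    obtain ⟨q, hq, hqi⟩ : ∃ q, R q ∧ ∀ v ∈ S i, v ∈ S i → Big (σ i) (b i) t v q := by
      let := s.topology (K := K)
      refine IsCompact.induction_on (p := fun Z => ∃ q, R q ∧
        ∀ v ∈ Z, v ∈ S i → Big (σ i) (b i) t v q) (hJ i hi).2.1 ?_ ?_ ?_ ?_
      · exact ⟨0, hR0, by simp⟩
      · rintro Z Z' hZ ⟨q, hq, hqZ⟩
        exact ⟨q, hq, fun v hv => hqZ v (hZ hv)⟩
      · rintro Z Z' ⟨q, hq, hqZ⟩ ⟨q', hq', hqZ'⟩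
        refine ⟨form f q q', hR _ _ hq hq', ?_⟩
        rintro v (hv | hv) hvS
        · exact hbig i hi v hvS _ _ (Or.inl (hqZ v hv hvS))
        · exact hbig i hi v hvS _ _ (Or.inr (hqZ' v hv hvS))
      · intro v hv
        obtain ⟨q, hq, hqv⟩ := h i hi v hv
        rw [(hJ i hi).1] at hqv ⊢
        exact ⟨{w | Big s (b i) t w q},
          mem_nhdsWithin_of_mem_nhds ((isOpen_setOf_big s (hb i) hS.ne_zero q).mem_nhds hqv),
          q, hq, fun w hw _ => hw⟩
    refine ⟨form f p q, hR _ _ hp hq, fun j hj v hv => ?_⟩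
    refine hbig j (hI hj) v hv _ _ ?_
    rcases Finset.mem_insert.mp hj with rfl | hj
    · exact Or.inr (hqi v hv hv)
    · exact Or.inl (hpI j hj v hv)

/-- Localities are added one at a time. Each one excludes finitely many exponents k, so some p² +
q^k is big at all of them. -/
theorem exists_big_of_finiteOn (hS : IsAdmissible s f t S σ) (hJ : FiniteOn S σ J)
    (hR0 : R 0) (hR : ∀ p q k, 2 ≤ k → R p → R q → R (p ^ 2 + q ^ k))
    (h : ∀ j ∈ J, ∀ v ∈ S j, ∃ p, R p ∧ Big (σ j) (b j) t v p) :
    ∃ p, R p ∧ ∀ j ∈ J, ∀ v ∈ S j, Big (σ j) (b j) t v p := by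
  classical
  let Z : Set (Fin n × Locality K) := {x | x.1 ∈ J ∧ x.2 ∈ S x.1}
  have hZ : Z.Finite := by
    refine (J.finite_toSet.biUnion (t := fun j => Prod.mk j '' S j)
      fun j hj => (hJ j hj).2.image _).subset ?_
    rintro ⟨j, v⟩ ⟨hj, hv⟩
    exact Set.mem_biUnion hj ⟨v, hv, rfl⟩
  suffices H : ∃ p, R p ∧ ∀ x ∈ Z, Big (σ x.1) (b x.1) t x.2 p by
    obtain ⟨p, hp, hpZ⟩ := H
    exact ⟨p, hp, fun j hj v hv => hpZ (j, v) ⟨hj, hv⟩⟩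
  refine hZ.induction_on_subset (motive := fun Y _ => ∃ p, R p ∧
    ∀ x ∈ Y, Big (σ x.1) (b x.1) t x.2 p) Z ⟨0, hR0, by simp⟩ ?_
  intro x Y hx hY _ ⟨p, hp, hpY⟩
  obtain ⟨q, hq, hqx⟩ := h x.1 hx.1 x.2 hx.2
  have hbig : ∀ y ∈ insert x Y, y ∈ Z ∧
      (Big (σ y.1) (b y.1) t y.2 p ∨ Big (σ y.1) (b y.1) t y.2 q) := by
    rintro y (rfl | hy)
    · exact ⟨hx, Or.inr hqx⟩
    · exact ⟨hY hy, Or.inl (hpY y hy)⟩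
  have hfin : (⋃ y ∈ insert x Y, {k : ℕ | y.2.size t * y.2.size p ^ 2 ≤ y.2.size q ^ k ∧
      y.2.size t * y.2.size q ^ k ≤ y.2.size p ^ 2}).Finite := by
    refine (hZ.subset (Set.insert_subset hx hY)).biUnion fun y hy => ?_
    obtain ⟨hyZ, hy⟩ := hbig y hy
    rw [(hJ _ hyZ.1).1] at hy
    exact finite_bad_exponents hS.ne_zero (hS.plus _ _ hyZ.2)
      (hy.imp (fun h => h.one_lt_sq_mul) fun h => h.one_lt_sq_mul)
  obtain ⟨k, hk⟩ := (hfin.union (Set.finite_lt_nat 2)).exists_notMem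
  simp only [Set.mem_union, Set.mem_iUnion, not_or, not_exists, Set.mem_ofPred_eq, not_lt] at hk
  refine ⟨p ^ 2 + q ^ k, hR _ _ _ hk.2 hp hq, fun y hy => ?_⟩
  obtain ⟨hyZ, hpq⟩ := hbig y hy
  exact Big.sq_add_pow hS.ne_zero (hS.plus _ _ hyZ.2) hk.2 (hk.1 y hy) hpq

theorem exists_big (hS : IsAdmissible s f t S σ) (hJ : FiniteOn S σ J ∨ CompactOn s f t S σ J)
    (hR0 : R 0) (hR : ∀ p q, R p → R q → R (form f p q))
    (hR' : ∀ p q k, 2 ≤ k → R p → R q → R (p ^ 2 + q ^ k)) (hb : ∀ j, b j ≠ 0)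
    (h : ∀ j ∈ J, ∀ v ∈ S j, ∃ p, R p ∧ Big (σ j) (b j) t v p) :
    ∃ p, R p ∧ ∀ j ∈ J, ∀ v ∈ S j, Big (σ j) (b j) t v p := by
  rcases hJ with hJ | hJ
  · exact exists_big_of_finiteOn hS hJ hR0 hR' h
  · exact exists_big_of_compactOn hS hJ hR0 hR hb h

/-- Separation of two families of localities. -/
theorem exists_separating (hS : IsAdmissible s f t S σ)
    (hI : FiniteOn S σ I ∨ CompactOn s f t S σ I) (hJ : FiniteOn S σ J ∨ CompactOn s f t S σ J)
    (ha : ∀ i, a i ≠ 0) (hb : ∀ i, b i ≠ 0) (hne : ∃ i ∈ I, (S i).Nonempty)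
    (h : ∀ i ∈ I, ∀ j ∈ J, ∀ v ∈ S i, ∀ w ∈ S j, ∃ y ≠ 0,
      Small (σ i) (a i) t v y ∧ Big (σ j) (b j) t w y) :
    ∃ y, (∀ i ∈ I, ∀ v ∈ S i, Small (σ i) (a i) t v y) ∧
      ∀ j ∈ J, ∀ w ∈ S j, Big (σ j) (b j) t w y := by
  have hform : ∀ (c : K) (i) (v) (_ : v ∈ S i) (p q : K), Small (σ i) c t v p →
      Small (σ i) c t v q → Small (σ i) c t v (form f p q) := fun c i v hv p q hp hq =>
    hp.small_form hS.ne_zero hS.two_le_natDegree (hS.plus i v hv) (hS.integral i v hv)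
      (hS.leading i v hv) hq
  have hpow : ∀ (c : K) (i) (v) (_ : v ∈ S i) (p q : K) (k : ℕ), 2 ≤ k → Small (σ i) c t v p →
      Small (σ i) c t v q → Small (σ i) c t v (p ^ 2 + q ^ k) := fun c i v hv p q k hk hp hq =>
    hp.sq_add_pow hS.ne_zero (hS.plus i v hv) hk hq
  refine exists_big (R := fun y => ∀ i ∈ I, ∀ v ∈ S i, Small (σ i) (a i) t v y) hS hJ
    (fun i _ v _ => small_zero (ha i) hS.ne_zero)
    (fun p q hp hq i hi v hv => hform _ i v hv p q (hp i hi v hv) (hq i hi v hv))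
    (fun p q k hk hp hq i hi v hv => hpow _ i v hv p q k hk (hp i hi v hv) (hq i hi v hv)) hb ?_
  intro j hj w hw
  -- With w fixed, the inverses of the pairwise separating elements are small at w and can be merged
  -- to one that is big on all of I. Inverting back gives the local input for J.
  obtain ⟨p, hpw, hpI⟩ := exists_big (b := a) (R := fun y => Small (σ j) (b j) t w y) hS hI
    (small_zero (hb j) hS.ne_zero) (hform _ j w hw) (hpow _ j w hw) ha (fun i hi v hv => by
      obtain ⟨y, hy0, hyv, hyw⟩ := h i hi j hj v hv w hw
      exact ⟨y⁻¹, hyw.2, inv_ne_zero hy0, by rwa [inv_inv]⟩)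
  -- Being big at one locality makes p nonzero, so p⁻¹ really is big at w.
  obtain ⟨i, hi, v, hv⟩ := hne
  exact ⟨p⁻¹, fun i hi v hv => (hpI i hi v hv).2, inv_ne_zero (hpI i hi v hv).1, by rwa [inv_inv]⟩

/-- The compatibility condition on the elements to be approximated. -/
def Compatible (S : Fin n → Set (Locality K)) (x z : Fin n → K) : Prop :=
  ∀ i j, ∀ v ∈ S i, ∀ w ∈ S j, ∀ A : ValuationSubring K,
    v ≤ ofValuation A → w ≤ ofValuation A →
      (ofValuation A).size (x i - x j) ≤ (ofValuation A).size (z i) ∧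
        (ofValuation A).size (z i) = (ofValuation A).size (z j)

/-- Simultaneous approximation is possible on the members of the family with index in `I`. -/
def Approximable (S : Fin n → Set (Locality K)) (σ : Fin n → Situation) (I : Finset (Fin n)) :
    Prop :=
  ∀ x z : Fin n → K, (∀ i, z i ≠ 0) → Compatible S x z →
    ∃ y, ∀ i ∈ I, ∀ v ∈ S i, (σ i).Rel (v.size (y - x i)) (v.size (z i))

theorem Compatible.mul_left (hS : IsAdmissible s f t S σ) {x z : Fin n → K}
    (h : Compatible S x z) : Compatible S x fun i => t * z i := by
  intro i j v hv w hw A hvA hwA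
  obtain ⟨h1, h2⟩ := h i j v hv w hw A hvA hwA
  by_cases hij : i = j
  · subst hij
    simp
  · rw [map_mul, map_mul, (hS.indep i j hij v hv w hw).valuation_eq_one hvA hwA, one_mul, one_mul]
    exact ⟨h1, h2⟩

theorem size_add_ofValuation (A : ValuationSubring K) {p q r : K}
    (hp : (ofValuation A).size p ≤ (ofValuation A).size r)
    (hq : (ofValuation A).size q ≤ (ofValuation A).size r) :
    (ofValuation A).size (p + q) ≤ (ofValuation A).size r := by
  rw [size_ofValuation_le] at *
  exact (A.valuation.map_add p q).trans (max_le hp hq)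

/-- The absence of approximate zeros on J is what makes a_d / F(1, y) small there; on I it is not
needed in Situation 𝔪. Hence in the mixed case the finite members are placed in I. -/
theorem exists_partition_of_separating (hS : IsAdmissible s f t S σ)
    (hI : FiniteOn S σ I ∨ CompactOn s f t S σ I)
    (hJ : (FiniteOn S σ I ∧ FiniteOn S σ J) ∨ CompactOn s f t S σ J)
    (hne : ∃ j ∈ J, (S j).Nonempty) {y : K}
    (hyI : ∀ i ∈ I, ∀ v ∈ S i, Small (σ i) (t ^ 2 * a i) t v y)
    (hyJ : ∀ j ∈ J, ∀ w ∈ S j, Big (σ j) (t ^ 2 * a j) t w y) :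
    ∃ e, (∀ i ∈ I, ∀ v ∈ S i, (σ i).Rel (v.size (1 - e)) (v.size (a i))) ∧
      ∀ j ∈ J, ∀ w ∈ S j, (σ j).Rel (w.size e) (w.size (a j)) := by
  rcases hJ with ⟨hI, hJ⟩ | hJ
  · refine ⟨(1 + y)⁻¹, fun i hi v hv => ?_, fun j hj w hw => ?_⟩
    · have := hyI i hi v hv
      rw [(hI i hi).1] at this ⊢
      exact this.rel_one_sub_inv hS.ne_zero (hS.plus i v hv)
    · have := hyJ j hj w hw
      rw [(hJ j hj).1] at this ⊢
      exact this.rel_inv hS.ne_zero (hS.plus j w hw)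
  · obtain ⟨j, hj, w, hw⟩ := hne
    have hy0 : y ≠ 0 := (hyJ j hj w hw).1
    refine ⟨f.leadingCoeff / form f 1 y, fun i hi v hv => ?_, fun j hj w hw => ?_⟩
    · refine (hyI i hi v hv).rel_one_sub_div_form hS.ne_zero hS.two_le_natDegree (hS.plus i v hv)
        (hS.leading i v hv) (hS.integral i v hv) ?_ hy0
      exact hI.imp (fun h => (h i hi).1) fun h => (h i hi).2.2 v hv
    · exact (hyJ j hj w hw).rel_div_form hS.ne_zero hS.two_le_natDegree (hS.plus j w hw)
        (hS.leading j w hw) ((hJ j hj).2.2 w hw)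

/-- The partial solutions p and q are taken with precision tz, and e with precision tz/(p - q),
since the final addition loses a factor t. By compatibility p - q is no larger than z on common
coarsenings, where t is a unit, so this quotient has size at least 1 there and pairwise separation
applies. -/
theorem Approximable.union [DecidableEq (Fin n)] (hS : IsAdmissible s f t S σ)
    (hIJ : Disjoint I J) (hI : FiniteOn S σ I ∨ CompactOn s f t S σ I)
    (hJ : (FiniteOn S σ I ∧ FiniteOn S σ J) ∨ CompactOn s f t S σ J)
    (hI' : Approximable S σ I) (hJ' : Approximable S σ J) : Approximable S σ (I ∪ J) := by
  intro x z hz hxz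
  have ht := hS.ne_zero
  by_cases hneI : ∃ i ∈ I, (S i).Nonempty
  swap
  · obtain ⟨y, hy⟩ := hJ' x z hz hxz
    refine ⟨y, fun i hi v hv => ?_⟩
    rcases Finset.mem_union.mp hi with hi | hi
    · exact absurd ⟨i, hi, v, hv⟩ hneI
    · exact hy i hi v hv
  by_cases hneJ : ∃ j ∈ J, (S j).Nonempty
  swap
  · obtain ⟨y, hy⟩ := hI' x z hz hxz
    refine ⟨y, fun i hi v hv => ?_⟩
    rcases Finset.mem_union.mp hi with hi | hi
    · exact hy i hi v hv
    · exact absurd ⟨i, hi, v, hv⟩ hneJ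
  have htz : ∀ i, t * z i ≠ 0 := fun i => mul_ne_zero ht (hz i)
  obtain ⟨p, hp⟩ := hI' x _ htz (hxz.mul_left hS)
  obtain ⟨q, hq⟩ := hJ' x _ htz (hxz.mul_left hS)
  by_cases hpq : p = q
  · subst hpq
    refine ⟨p, fun i hi v hv => rel_of_rel_mul ht (hS.plus i v hv) ?_⟩
    rcases Finset.mem_union.mp hi with hi | hi
    exacts [hp i hi v hv, hq i hi v hv]
  have hc : p - q ≠ 0 := sub_ne_zero.mpr hpq
  have ha : ∀ i, t ^ 2 * (t * z i / (p - q)) ≠ 0 := fun i =>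
    mul_ne_zero (pow_ne_zero 2 ht) (div_ne_zero (htz i) hc)
  obtain ⟨y, hyI, hyJ⟩ := exists_separating (a := fun i => t ^ 2 * (t * z i / (p - q)))
    (b := fun i => t ^ 2 * (t * z i / (p - q))) hS hI (hJ.imp_left And.right) ha ha hneI (by
      intro i hi j hj v hv w hw
      have hij : i ≠ j := fun h => Finset.disjoint_left.mp hIJ hi (h ▸ hj)
      refine exists_small_and_big ht (hS.plus i v hv) (hS.plus j w hw) (hS.indep i j hij v hv w hw)
        (hS.not_le i j hij v hv w hw) (hS.not_le j i hij.symm w hw v hv) ?_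
      intro A hvA hwA
      have htA := (hS.indep i j hij v hv w hw).valuation_eq_one hvA hwA
      obtain ⟨h1, h2⟩ := hxz i j v hv w hw A hvA hwA
      have h3 : (ofValuation A).size (p - x i) ≤ (ofValuation A).size (z i) := by
        have := size_le_size_of_le hvA (hp i hi v hv).le
        rwa [map_mul, htA, one_mul] at this
      have h4 : (ofValuation A).size (x j - q) ≤ (ofValuation A).size (z i) := by
        have := size_le_size_of_le hwA (hq j hj w hw).le
        rwa [map_mul, htA, one_mul, ← h2, size_sub_comm] at this
      have h5 : (ofValuation A).size (p - q) ≤ (ofValuation A).size (z i) := by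
        have := size_add_ofValuation A (size_add_ofValuation A h3 h1) h4
        rwa [sub_add_sub_cancel, sub_add_sub_cancel] at this
      simp only [map_mul, map_pow, map_div₀, htA, one_pow, one_mul, ← h2]
      exact ⟨(one_le_div₀ (size_pos hc)).mpr h5, (one_le_div₀ (size_pos hc)).mpr h5⟩)
  obtain ⟨e, heI, heJ⟩ := exists_partition_of_separating (a := fun i => t * z i / (p - q))
    hS hI hJ hneJ hyI hyJ
  have hmul : ∀ (v : Locality K) (τ : Situation) (r c : K),
      τ.Rel (v.size r) (v.size (c / (p - q))) → τ.Rel (v.size ((p - q) * r)) (v.size c) := by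
    intro v τ r c h
    have := h.mul_left (size_pos (v := v) hc)
    rwa [← map_mul, ← map_mul, mul_div_cancel₀ _ hc] at this
  refine ⟨q + (p - q) * e, fun i hi v hv => ?_⟩
  rcases Finset.mem_union.mp hi with hi | hi
  · have h1 := hmul v _ _ _ (heI i hi v hv)
    rw [← size_neg] at h1
    have := rel_add ht (hS.plus i v hv) (hp i hi v hv) h1
    convert this using 2
    ring
  · have := rel_add ht (hS.plus i v hv) (hq i hi v hv) (hmul v _ _ _ (heJ i hi v hv))
    convert this using 2
    ring

theorem approximable_of_homogeneous (hS : IsAdmissible s f t S σ)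
    (hI : FiniteOn S σ I ∨ CompactOn s f t S σ I) : Approximable S σ I := by
  classical
  suffices H : ∀ J ⊆ I, Approximable S σ J from H I subset_rfl
  intro J
  induction J using Finset.induction_on with
  | empty => exact fun _ x z _ _ => ⟨0, by simp⟩
  | insert i J hi ih =>
    intro hJ
    have hiI : {i} ⊆ I := Finset.singleton_subset_iff.mpr (hJ (Finset.mem_insert_self _ _))
    have hJI : J ⊆ I := fun j hj => hJ (Finset.mem_insert_of_mem hj)
    rw [Finset.insert_eq]
    refine Approximable.union hS (Finset.disjoint_singleton_left.mpr hi) ?_ ?_ ?_ (ih hJI)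
    · exact hI.imp (fun h j hj => h j (hiI hj)) fun h j hj => h j (hiI hj)
    · exact hI.imp (fun h => ⟨fun j hj => h j (hiI hj), fun j hj => h j (hJI hj)⟩)
        fun h j hj => h j (hJI hj)
    · intro x z hz _
      refine ⟨x i, fun j hj v _ => ?_⟩
      rw [Finset.mem_singleton.mp hj, sub_self, map_zero]
      exact Situation.rel_of_lt (size_pos (hz i))

theorem approximable_univ (hS : IsAdmissible s f t S σ)
    (h : ∀ i, (σ i = .m ∧ (S i).Finite) ∨
      (σ i = s ∧ @IsCompact _ s.topology (S i) ∧ ∀ v ∈ S i, CondNoApproxZero f t v)) :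
    Approximable S σ Finset.univ := by
  classical
  let P : Fin n → Prop := fun i => σ i = .m ∧ (S i).Finite
  have hI : FiniteOn S σ (Finset.univ.filter P) := fun i hi => (Finset.mem_filter.mp hi).2
  have hJ : CompactOn s f t S σ (Finset.univ.filter fun i => ¬ P i) := fun i hi =>
    (h i).resolve_left (Finset.mem_filter.mp hi).2
  have := Approximable.union hS (Finset.disjoint_filter_filter_not _ _ P) (Or.inl hI) (Or.inr hJ)
    (approximable_of_homogeneous hS (Or.inl hI)) (approximable_of_homogeneous hS (Or.inr hJ))
  rwa [Finset.filter_union_filter_not_eq] at this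

end Locality

/-! ### Thinning out the finite members -/

namespace Locality
variable {K : Type u} [Field K] {n : ℕ} {S : Fin n → Set (Locality K)} {t : K}

/-- The finite members of a family can be shrunk until they contain no coarsening of an element of
another member, keeping a refinement of every locality of the family. -/
theorem exists_reduced_family (S : Fin n → Set (Locality K)) :
    ∃ S' : Fin n → Set (Locality K), (∀ i, S' i ⊆ S i) ∧ (∀ i, ¬ (S i).Finite → S' i = S i) ∧
      (∀ i, ∀ v ∈ S i, ∃ j, ∃ w ∈ S' j, w ≤ v) ∧
      ∀ i j, i ≠ j → (S i).Finite → ∀ v ∈ S' i, ∀ w ∈ S' j, ¬ w ≤ v := by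
  classical
  let D : Set (Fin n → Set (Locality K)) := {S' | (∀ i, S' i ⊆ S i) ∧
    (∀ i, ¬ (S i).Finite → S' i = S i) ∧ ∀ i, ∀ v ∈ S i, ∃ j, ∃ w ∈ S' j, w ≤ v}
  let μ : (Fin n → Set (Locality K)) → ℕ := fun S' =>
    ∑ i ∈ Finset.univ.filter (fun i => (S i).Finite), (S' i).ncard
  obtain ⟨S', ⟨h1, h2, h3⟩, hmin⟩ := (measure μ).wf.has_min D
    ⟨S, fun _ => subset_rfl, fun _ _ => rfl, fun i v hv => ⟨i, v, hv, le_rfl⟩⟩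
  refine ⟨S', h1, h2, h3, fun i j hij hi v hv w hw hwv => ?_⟩
  -- A minimal family admits no further removal: if v coarsens w in another member, w takes over the
  -- role of v as a refinement, so v could be dropped.
  refine hmin (Function.update S' i (S' i \ {v})) ⟨fun k => ?_, fun k hk => ?_, fun k u hu => ?_⟩ ?_
  · obtain rfl | hk := eq_or_ne k i
    · rw [Function.update_self]
      exact Set.sdiff_subset.trans (h1 k)
    · rw [Function.update_of_ne hk]
      exact h1 k
  · rw [Function.update_of_ne (by rintro rfl; exact hk hi)]
    exact h2 k hk
  · obtain ⟨l, u', hu', hle⟩ := h3 k u hu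
    by_cases hl : l = i ∧ u' = v
    · refine ⟨j, w, ?_, hwv.trans (hl.2 ▸ hle)⟩
      rwa [Function.update_of_ne hij.symm]
    · refine ⟨l, u', ?_, hle⟩
      obtain rfl | hli := eq_or_ne l i
      · rw [Function.update_self]
        exact ⟨hu', fun h => hl ⟨rfl, h⟩⟩
      · rwa [Function.update_of_ne hli]
  · have hlt : (S' i \ {v}).ncard < (S' i).ncard :=
      Set.ncard_sdiff_singleton_lt_of_mem hv (hi.subset (h1 i))
    change μ _ < μ _
    refine Finset.sum_lt_sum (fun k _ => ?_) ⟨i, by simpa using hi, by rwa [Function.update_self]⟩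
    obtain rfl | hk := eq_or_ne k i
    · rw [Function.update_self]
      exact hlt.le
    · rw [Function.update_of_ne hk]

theorem compatible_of_hasRefinementIn {x z : Fin n → K}
    (h : ∀ i j, ∀ w : ValuationSubring K, HasRefinementIn w (S i) → HasRefinementIn w (S j) →
      w.valuation (x i - x j) ≤ w.valuation (z i) ∧ w.valuation (z i) = w.valuation (z j)) :
    Compatible S x z := by
  intro i j v hv w hw A hvA hwA
  obtain ⟨h1, h2⟩ := h i j A ⟨v, hv, hvA⟩ ⟨w, hw, hwA⟩
  exact ⟨size_ofValuation_le.mpr h1,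
    le_antisymm (size_ofValuation_le.mpr h2.le) (size_ofValuation_le.mpr h2.ge)⟩

theorem Compatible.mono {S' : Fin n → Set (Locality K)} {x z : Fin n → K} (h : Compatible S x z)
    (hS : ∀ i, S' i ⊆ S i) : Compatible S' x z :=
  fun i j v hv w hw => h i j v (hS i hv) w (hS j hw)

end Locality

/-! ### The approximation theorem in both situations -/

open Locality in
theorem mainTheorem2 {K : Type*} [Field K] (s : Situation) (n : ℕ)
    (S : Fin n → Set (Locality K)) (t : K) (ht : t ≠ 0)
    (x : Fin n → K) (z : Fin n → K) (hz : ∀ i, z i ≠ 0)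
    (hU : ExceptionalAssumption S t)
    (hT : ∀ i, @IsCompact (Locality K) s.topology (S i))
    (hI : ∀ i j, ∀ w : ValuationSubring K,
      Locality.HasRefinementIn w (S i) → Locality.HasRefinementIn w (S j) →
        w.valuation (x i - x j) ≤ w.valuation (z i) ∧ w.valuation (z i) = w.valuation (z j))
    (hindep : ∀ i j, i ≠ j → ∀ v ∈ S i, ∀ v' ∈ S j, Locality.TIndependent t v v')
    (hincomp : s = Situation.m →
      ∀ i j, i ≠ j → ∀ v ∈ S i, ∀ v' ∈ S j, Locality.Incomparable v v') :
    ∃ y : K, ∀ i, ∀ v ∈ S i, y - x i ∈ z i • s.ball v := by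
  classical
  obtain ⟨f, hd, hf, hzero⟩ := hU
  have hxz := compatible_of_hasRefinementIn hI
  simp only [Situation.mem_smul_ball _ (hz _)]
  cases s with
  | m =>
    have hS : IsAdmissible .m f t S fun _ => .m := ⟨ht, hd, fun i v hv => (hf i v hv).1,
      fun i v hv => (hf i v hv).2.1, fun i v hv => (hf i v hv).2.2, hindep,
      fun i j hij v hv w hw _ => (hincomp rfl i j hij v hv w hw).2⟩
    obtain ⟨y, hy⟩ := approximable_univ hS (fun i => by
      by_cases hi : (S i).Finite
      · exact Or.inl ⟨rfl, hi⟩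
      · exact Or.inr ⟨rfl, hT i, hzero i hi⟩) x z hz hxz
    exact ⟨y, fun i => hy i (Finset.mem_univ i)⟩
  | O =>
    -- After thinning, finite members satisfy the incomparability needed to demand strict
    -- inequalities on them, while infinite members keep the non-strict ones.
    obtain ⟨S', h1, h2, h3, h4⟩ := exists_reduced_family S
    have hS : IsAdmissible .O f t S' fun i => if (S i).Finite then .m else .O :=
      ⟨ht, hd, fun i v hv => (hf i v (h1 i hv)).1,
        fun i v hv => (hf i v (h1 i hv)).2.1, fun i v hv => (hf i v (h1 i hv)).2.2,
        fun i j hij v hv w hw => hindep i j hij v (h1 i hv) w (h1 j hw),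
        fun i j hij v hv w hw hi => h4 i j hij (by simpa using hi) v hv w hw⟩
    obtain ⟨y, hy⟩ := approximable_univ hS (fun i => by
      by_cases hi : (S i).Finite
      · exact Or.inl ⟨if_pos hi, hi.subset (h1 i)⟩
      · rw [h2 i hi]
        exact Or.inr ⟨if_neg hi, hT i, hzero i hi⟩) x z hz (hxz.mono h1)
    refine ⟨y, fun i v hv => ?_⟩
    obtain ⟨j, w, hw, hwv⟩ := h3 i v hv
    have h5 := size_le_size_of_le hwv (hy j (Finset.mem_univ j) w hw).le
    obtain rfl | hij := eq_or_ne j i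
    · exact h5
    -- A locality v coarsening w from another member is a valuation, so compatibility at v itself
    -- allows x_j and z_j to be exchanged for x_i and z_i.
    obtain ⟨A, rfl⟩ := (hindep j i hij w (h1 j hw) v hv).exists_eq_ofValuation_of_le ht
      (hf i v hv).2.2 hwv
    obtain ⟨h6, h7⟩ := hxz i j _ hv w (h1 j hw) A le_rfl hwv
    rw [size_sub_comm] at h6
    have := size_add_ofValuation A (h5.trans h7.ge) h6
    rwa [sub_add_sub_cancel] at this
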